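/- A group $G$ is a Jordan group if there is an integer $d>0$ such that every finite subgroup $H\le G$ contains an abelian normal subgroup of $H$ of index at most $d$ in $H$; the least such $d$ is the Jordan constant $J_G$. Let $\mathcal D$ be a quaternion division algebra over $\mathbb Q$, that is, a division algebra with centre $\mathbb Q$ and $\dim_{\mathbb Q}\mathcal D=4$. Let $R_{\mathcal D}$ be the set of places $v$ of $\mathbb Q$ (primes and $\infty$) at which $\mathcal D$ is ramified, i.e. for which $\mathbb Q_v\otimes_{\mathbb Q}\mathcal D$ is a division algebra, where $\mathbb Q_\infty=\mathbb R$. Then $\mathcal D^\times$ is a Jordan group, and \[ J_{\mathcal D^\times}=12 \iff R_{\mathcal D}=\{2,\infty\},\qquad J_{\mathcal D^\times}=2 \iff R_{\mathcal D}=\{3,\infty\}, \] and $J_{\mathcal D^\times}=1$ if and only if $R_{\mathcal D}$ is neither $\{2,\infty\}$ nor $\{3,\infty\}$. Moreover, every finite subgroup of $\mathcal D^\times$ is isomorphic to the binary tetrahedral group $\mathfrak T^*$ (of order $24$), to the dicyclic group $\mathrm{Dic}_{12}$ of order $12$, to the quaternion group $Q_8$, or is cyclic. -/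

import Mathlib

open scoped TensorProduct Quaternion

/-- Every finite subgroup of `G` contains an abelian normal subgroup of index at most `d`. -/
def IsJordanBound (G : Type*) [Group G] (d : ℕ) : Prop :=
  ∀ H : Subgroup G, Finite H →
    ∃ A : Subgroup H, A.Normal ∧ (∀ x ∈ A, ∀ y ∈ A, x * y = y * x) ∧ A.index ≤ d

/-- `G` is a Jordan group. -/
def IsJordanGroup (G : Type*) [Group G] : Prop :=
  ∃ d : ℕ, 0 < d ∧ IsJordanBound G d

/-- The Jordan constant of `G`: the least positive Jordan bound (meaningful for Jordan groups). -/
noncomputable def jordanConstant (G : Type*) [Group G] : ℕ :=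
  sInf {d : ℕ | 0 < d ∧ IsJordanBound G d}

/-- The places of `ℚ`: the primes and the infinite place. -/
inductive RatPlace : Type
  | finite (p : ℕ) (hp : p.Prime) : RatPlace
  | infinite : RatPlace

/-- The base change `K ⊗ D` is a division ring: each nonzero element is invertible. -/
def IsDivisionOver (K : Type*) [Field K] [Algebra ℚ K]
    (D : Type*) [Ring D] [Algebra ℚ D] : Prop :=
  ∀ x : K ⊗[ℚ] D, x ≠ 0 → IsUnit x

/-- A quaternion algebra over `ℚ` is ramified at a place `v` if it remains a division algebra
over the completion of `ℚ` at `v`, which is `ℚ_[p]` or `ℝ`. -/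
def IsRamifiedAt (D : Type*) [Ring D] [Algebra ℚ D] : RatPlace → Prop
  | .finite p hp => haveI : Fact p.Prime := ⟨hp⟩; IsDivisionOver ℚ_[p] D
  | .infinite => IsDivisionOver ℝ D

/-- The set of places of `ℚ` at which `D` is ramified. -/
def ramificationSet (D : Type*) [Ring D] [Algebra ℚ D] : Set RatPlace :=
  {v | IsRamifiedAt D v}

/-- The prime `2` as a place of `ℚ`. -/
def placeTwo : RatPlace := .finite 2 Nat.prime_two

/-- The prime `3` as a place of `ℚ`. -/
def placeThree : RatPlace := .finite 3 Nat.prime_three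

/-- The quaternion `q` lies in the Hurwitz order `ℤ + ℤ i + ℤ j + ℤ (1 + i + j + k) / 2`. -/
def IsHurwitz (q : ℍ[ℚ]) : Prop :=
  ∃ a b c d : ℤ, q.re = a + d / 2 ∧ q.imI = b + d / 2 ∧ q.imJ = c + d / 2 ∧ q.imK = d / 2

theorem IsHurwitz.mul {p q : ℍ[ℚ]} (hp : IsHurwitz p) (hq : IsHurwitz q) :
    IsHurwitz (p * q) := by
  obtain ⟨a, b, c, d, h0, h1, h2, h3⟩ := hp
  obtain ⟨a', b', c', d', h0', h1', h2', h3'⟩ := hq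
  refine ⟨a * a' - b * b' - b * c' - b * d' + c * b' - c * c' - d * c' - d * d',
    a * b' + b * a' - b * c' + c * b' + c * d' + d * b' - d * c',
    a * c' - b * c' - b * d' + c * a' + c * b' + c * d' + d * b',
    a * d' + 2 * b * c' + b * d' - 2 * c * b' - c * d' + d * a' - d * b' + d * c' + d * d', ?_⟩
  simp only [Quaternion.re_mul, Quaternion.imI_mul, Quaternion.imJ_mul, Quaternion.imK_mul,
    h0, h1, h2, h3, h0', h1', h2', h3']
  push_cast
  refine ⟨?_, ?_, ?_, ?_⟩ <;> ring

/-- The binary tetrahedral group, as the group of the 24 Hurwitz quaternions of norm `1`: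
`±1, ±i, ±j, ±k` and `(±1 ± i ± j ± k) / 2`. -/
def binaryTetrahedralGroup : Subgroup ℍ[ℚ]ˣ where
  carrier := {u | IsHurwitz (u : ℍ[ℚ]) ∧ Quaternion.normSq (u : ℍ[ℚ]) = 1}
  one_mem' := by
    refine ⟨⟨1, 0, 0, 0, ?_⟩, by simp⟩
    simp
  mul_mem' := by
    rintro u v ⟨hu, hu'⟩ ⟨hv, hv'⟩
    exact ⟨by simpa using hu.mul hv, by simp [hu', hv']⟩
  inv_mem' := by
    rintro u ⟨⟨a, b, c, d, h0, h1, h2, h3⟩, hu'⟩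
    have hs : ((u⁻¹ : ℍ[ℚ]ˣ) : ℍ[ℚ]) = star (u : ℍ[ℚ]) := by
      apply Units.inv_eq_of_mul_eq_one_right
      rw [Quaternion.self_mul_star, hu', Quaternion.coe_one]
    refine ⟨⟨a + d, -b, -c, -d, ?_⟩, ?_⟩
    · simp only [hs, Quaternion.re_star, Quaternion.imI_star, Quaternion.imJ_star,
        Quaternion.imK_star, h0, h1, h2, h3]
      push_cast
      refine ⟨?_, ?_, ?_, ?_⟩ <;> ring
    · rw [hs, Quaternion.normSq_star, hu']

/-!
A finite subgroup of `Dˣ` consists of elements of degree at most two over `ℚ`, so each `g` in it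
satisfies `g + g⁻¹ = t` with an integer `-2 ≤ t ≤ 2`. If the subgroup contains anticommuting
square roots of `-1`, then `D` is the algebra `(-1, -1)` and the integrality of the traces puts
the subgroup inside the group of Hurwitz units. Otherwise the five possible traces leave only an
abelian, hence cyclic, group, or an element of order three inverted by an element of order four;
the latter two generate a dicyclic group of order twelve and identify `D` with `(-1, -3)`.

It remains to recognise `(-1, -1)` and `(-1, -3)` from their ramification. An algebra ramified at
`∞` but split at all primes other than `2` and `3` is brought to the form `(-1, -1)` or `(-1, -3)`
by solving a ternary Legendre equation: the local conditions make the equation a multiple of an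
integral positive definite ternary form of determinant at most three, and Hermite's bound shows
that such a form represents `1`.
-/

section QuaternionBases

open Polynomial QuaternionAlgebra

variable {F : Type*} [Field F]

/-- `A` contains anticommuting elements with squares `a` and `b`; equivalently, there is a
homomorphism from the quaternion algebra `(a, b)` over `F` to `A`. -/
def HasQuaternionBasis (A : Type*) [Ring A] [Algebra F A] (a b : F) : Prop :=
  Nonempty (Basis A a 0 b)

/-- The basis datum `i, j, ij` of a quaternion algebra `(a, b)` inside `A` given by anticommuting
elements `i`, `j` with squares `a` and `b`. -/
def basisOfAnticommute {A : Type*} [Ring A] [Algebra F A] {a b : F} {i j : A}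
    (hi : i * i = algebraMap F A a) (hj : j * j = algebraMap F A b) (hij : j * i = -(i * j)) :
    Basis A a 0 b where
  i := i
  j := j
  k := i * j
  i_mul_i := by rw [hi, Algebra.algebraMap_eq_smul_one, zero_smul, add_zero]
  j_mul_j := by rw [hj, Algebra.algebraMap_eq_smul_one]
  i_mul_j := rfl
  j_mul_i := by rw [hij, zero_smul, zero_sub]

theorem HasQuaternionBasis.of_anticommute {A : Type*} [Ring A] [Algebra F A] {a b : F} {i j : A}
    (hi : i * i = algebraMap F A a) (hj : j * j = algebraMap F A b) (hij : j * i = -(i * j)) :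
    HasQuaternionBasis A a b :=
  ⟨basisOfAnticommute hi hj hij⟩

theorem HasQuaternionBasis.exists_anticommute {A : Type*} [Ring A] [Algebra F A] {a b : F} :
    HasQuaternionBasis A a b →
      ∃ i j : A, i * i = algebraMap F A a ∧ j * j = algebraMap F A b ∧ j * i = -(i * j) := by
  rintro ⟨q⟩
  refine ⟨q.i, q.j, ?_, ?_, by simp⟩ <;> simp [Algebra.algebraMap_eq_smul_one]

theorem HasQuaternionBasis.map {A B : Type*} [Ring A] [Algebra F A] [Ring B] [Algebra F B]
    {a b : F} (f : A →ₐ[F] B) : HasQuaternionBasis A a b → HasQuaternionBasis B a b :=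
  Nonempty.map (·.compHom f)

theorem quaternion_sum_conj {R : Type*} [CommRing R] {a b : R} (x : ℍ[R,a,b]) :
    (a * b) • x + b • ((Basis.self R).i * x * (Basis.self R).i) +
        a • ((Basis.self R).j * x * (Basis.self R).j) - (Basis.self R).k * x * (Basis.self R).k =
      algebraMap R ℍ[R,a,b] (4 * a * b * x.re) := by
  ext <;> simp [QuaternionAlgebra.algebraMap_eq] <;> ring

section liftHom

variable [NeZero (2 : F)] {A : Type*} [Ring A] [Nontrivial A] [Algebra F A] {a b : F}

theorem re_eq_zero_of_liftHom_eq_zero (q : Basis A a 0 b) (ha : a ≠ 0) (hb : b ≠ 0)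
    {x : ℍ[F,a,b]} (hx : q.liftHom x = 0) : x.re = 0 := by
  have hsum : algebraMap F A (4 * a * b * x.re) = 0 := by
    rw [← q.liftHom.commutes, ← quaternion_sum_conj x]
    simp only [map_sub, map_add, map_smul, map_mul, hx, mul_zero, zero_mul, smul_zero, add_zero,
      sub_zero]
  have h4 : (4 : F) ≠ 0 := by
    rw [show (4 : F) = 2 * 2 by norm_num]
    exact mul_ne_zero two_ne_zero two_ne_zero
  rw [map_eq_zero_iff _ (algebraMap F A).injective] at hsum
  simpa [ha, hb, h4] using hsum

theorem liftHom_injective_of_ne_zero (q : Basis A a 0 b) (ha : a ≠ 0) (hb : b ≠ 0) :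
    Function.Injective q.liftHom := by
  rw [injective_iff_map_eq_zero]
  intro x hx
  have hre (y : ℍ[F,a,b]) : (x * y).re = 0 :=
    re_eq_zero_of_liftHom_eq_zero q ha hb (by rw [map_mul, hx, zero_mul])
  ext
  · simpa using hre 1
  · simpa [ha] using hre (Basis.self F).i
  · simpa [hb] using hre (Basis.self F).j
  · simpa [ha, hb] using hre (Basis.self F).k

theorem liftHom_bijective_of_finrank_eq_four (hA : Module.finrank F A = 4) (q : Basis A a 0 b)
    (ha : a ≠ 0) (hb : b ≠ 0) : Function.Bijective q.liftHom := by
  have : FiniteDimensional F A := Module.finite_of_finrank_eq_succ hA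
  have hinj := liftHom_injective_of_ne_zero q ha hb
  exact ⟨hinj, (LinearMap.injective_iff_surjective_of_finrank_eq_finrank
    (f := q.liftHom.toLinearMap) (by rw [hA, finrank_eq_four])).1 hinj⟩

end liftHom

section Central

variable {D : Type*} [Ring D] [Algebra F D]

theorem exists_eq_algebraMap_of_forall_commute [Algebra.IsCentral F D] {x : D}
    (h : ∀ y, y * x = x * y) : ∃ r, x = algebraMap F D r := by
  obtain ⟨r, hr⟩ := Algebra.mem_bot.1
    (Algebra.IsCentral.out (Subalgebra.mem_center_iff.2 h) : x ∈ (⊥ : Subalgebra F D))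
  exact ⟨r, hr.symm⟩

theorem exists_ne_algebraMap_of_one_lt_finrank [Nontrivial D] (hD : 1 < Module.finrank F D) :
    ∃ x : D, ∀ r, x ≠ algebraMap F D r := by
  by_contra! h
  refine hD.not_ge (finrank_le_one (1 : D) fun x ↦ ?_)
  obtain ⟨r, rfl⟩ := h x
  exact ⟨r, (Algebra.algebraMap_eq_smul_one r).symm⟩

theorem adjoin_singleton_ne_top_of_one_lt_finrank [Nontrivial D] [Algebra.IsCentral F D]
    (hD : 1 < Module.finrank F D) (x : D) : Algebra.adjoin F {x} ≠ ⊤ := by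
  intro htop
  obtain ⟨y, hy⟩ := exists_ne_algebraMap_of_one_lt_finrank hD
  have : IsMulCommutative (Algebra.adjoin F {x}) := Algebra.isMulCommutative_adjoin F (by simp)
  have hmem (z : D) : z ∈ Algebra.adjoin F {x} := htop ▸ Algebra.mem_top
  obtain ⟨r, hr⟩ := exists_eq_algebraMap_of_forall_commute (F := F) (x := y) fun z ↦
    congrArg Subtype.val (mul_comm (⟨z, hmem z⟩ : Algebra.adjoin F {x}) ⟨y, hmem y⟩)
  exact hy r hr

variable [IsDomain D] [Algebra.IsCentral F D]

theorem natDegree_minpoly_le_two (hD : Module.finrank F D = 4) (x : D) :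
    (minpoly F x).natDegree ≤ 2 := by
  have : FiniteDimensional F D := Module.finite_of_finrank_eq_succ hD
  let K := Algebra.adjoin F {x}
  have hdvd : Module.finrank F K ∣ 4 := by
    have : IsMulCommutative K := Algebra.isMulCommutative_adjoin F (by simp)
    let _ : Field K := fieldOfFiniteDimensional F K
    exact hD ▸ ⟨_, (Module.finrank_mul_finrank F K D).symm⟩
  have hlt : Module.finrank F K < 4 := hD ▸ Submodule.finrank_lt fun htop ↦
    adjoin_singleton_ne_top_of_one_lt_finrank (F := F) (by omega) x
      (Algebra.toSubmodule_eq_top.1 htop)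
  have hle : Module.finrank F K ≤ 2 := by
    interval_cases Module.finrank F K <;> omega
  let y : K := ⟨x, Algebra.self_mem_adjoin_singleton F x⟩
  have hmin : minpoly F x = minpoly F y := minpoly.algHom_eq K.val Subtype.val_injective y
  exact hmin ▸ (minpoly.natDegree_le y).trans hle

theorem exists_mul_self_eq_smul_add_algebraMap (hD : Module.finrank F D = 4) (x : D) :
    ∃ s t : F, x * x = s • x + algebraMap F D t := by
  have : FiniteDimensional F D := Module.finite_of_finrank_eq_succ hD
  let P := minpoly F x * X ^ (2 - (minpoly F x).natDegree)
  have hmonic : P.Monic := (minpoly.monic (.of_finite F x)).mul (monic_X_pow _)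
  have hdeg : P.natDegree = 2 := by
    rw [(minpoly.monic (.of_finite F x)).natDegree_mul (monic_X_pow _), natDegree_X_pow]
    have := natDegree_minpoly_le_two hD x
    omega
  have hroot : aeval x P = 0 := by rw [map_mul, minpoly.aeval, zero_mul]
  have hlead : P.coeff 2 = 1 := by rw [← hdeg]; exact hmonic
  rw [aeval_eq_sum_range, hdeg] at hroot
  simp only [Finset.sum_range_succ, Finset.range_zero, Finset.sum_empty, hlead, pow_zero, pow_one,
    one_smul, zero_add, sq] at hroot
  refine ⟨-P.coeff 1, -P.coeff 0, ?_⟩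
  rw [Algebra.algebraMap_eq_smul_one]
  linear_combination (norm := module) hroot

variable [NeZero (2 : F)]

theorem exists_mul_self_eq_algebraMap_of_anticommute (hD : Module.finrank F D = 4) {i j : D}
    (hi : i ≠ 0) (hj : j ≠ 0) (hij : j * i = -(i * j)) :
    ∃ b : F, b ≠ 0 ∧ j * j = algebraMap F D b := by
  obtain ⟨s, t, hst⟩ := exists_mul_self_eq_smul_add_algebraMap hD j
  have hcomm : i * (j * j) = j * j * i := by
    rw [mul_assoc j, hij, mul_neg, ← mul_assoc j, hij, neg_mul, neg_neg, mul_assoc]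
  have hs : (2 * s) • (i * j) = 0 := by
    rw [hst, mul_add, add_mul, mul_smul_comm, smul_mul_assoc, hij, Algebra.commutes] at hcomm
    linear_combination (norm := module) hcomm
  obtain rfl : s = 0 := by simpa [hi, hj, two_ne_zero] using hs
  rw [zero_smul, zero_add] at hst
  refine ⟨t, ?_, hst⟩
  rintro rfl
  simp [hj] at hst

theorem exists_hasQuaternionBasis_of_mul_self (hD : Module.finrank F D = 4) {i : D} {a : F}
    (hi : i * i = algebraMap F D a) (hi' : ∀ r, i ≠ algebraMap F D r) :
    ∃ b : F, b ≠ 0 ∧ HasQuaternionBasis D a b := by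
  obtain ⟨y, hy⟩ : ∃ y, y * i ≠ i * y := by
    by_contra! h
    obtain ⟨r, hr⟩ := exists_eq_algebraMap_of_forall_commute (F := F) h
    exact hi' r hr
  have hanti : (i * y - y * i) * i = -(i * (i * y - y * i)) := by
    rw [sub_mul, mul_sub, ← mul_assoc i i, hi, mul_assoc y i, hi, ← Algebra.commutes, mul_assoc i]
    abel
  have hi0 : i ≠ 0 := by simpa using hi' 0
  obtain ⟨b, hb, hb'⟩ := exists_mul_self_eq_algebraMap_of_anticommute hD hi0
    (sub_ne_zero.2 hy.symm) hanti
  exact ⟨b, hb, .of_anticommute hi hb' hanti⟩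

theorem exists_hasQuaternionBasis (hD : Module.finrank F D = 4) :
    ∃ a b : F, a ≠ 0 ∧ b ≠ 0 ∧ HasQuaternionBasis D a b := by
  obtain ⟨x, hx⟩ := exists_ne_algebraMap_of_one_lt_finrank (F := F) (D := D) (by omega)
  obtain ⟨s, t, hst⟩ := exists_mul_self_eq_smul_add_algebraMap hD x
  let i := x - algebraMap F D (s / 2)
  have hi : i * i = algebraMap F D (t + (s / 2) ^ 2) := by
    have hs : s • x = (2 * (s / 2)) • x := by rw [mul_div_cancel₀ s two_ne_zero]
    rw [sub_mul, mul_sub, mul_sub, ← Algebra.commutes (s / 2) x, hst, hs]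
    simp only [Algebra.algebraMap_eq_smul_one, smul_mul_assoc, one_mul, smul_smul]
    module
  have hi' (r : F) : i ≠ algebraMap F D r := fun h ↦ hx (r + s / 2) <| by
    rw [map_add, ← h, sub_add_cancel]
  obtain ⟨b, hb, h⟩ := exists_hasQuaternionBasis_of_mul_self hD hi hi'
  refine ⟨_, b, ?_, hb, h⟩
  intro h0
  rw [h0, map_zero, mul_self_eq_zero] at hi
  exact hi' 0 (by rw [hi, map_zero])

end Central

/-- The norm form `x² - a y² - b z² + a b w²` of the quaternion algebra `(a, b)` over `K` has no
nontrivial zero. -/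
def IsNormFormAnisotropic {K : Type*} [Field K] (a b : K) : Prop :=
  ∀ x y z w : K, x ^ 2 - a * y ^ 2 - b * z ^ 2 + a * b * w ^ 2 = 0 →
    x = 0 ∧ y = 0 ∧ z = 0 ∧ w = 0

theorem quaternion_mul_star {R : Type*} [CommRing R] {a b : R} (q : ℍ[R,a,b]) :
    q * star q = algebraMap R ℍ[R,a,b]
      (q.re ^ 2 - a * q.imI ^ 2 - b * q.imJ ^ 2 + a * b * q.imK ^ 2) := by
  ext <;> simp [QuaternionAlgebra.algebraMap_eq] <;> ring

theorem forall_isUnit_quaternion_iff {a b : F} :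
    (∀ q : ℍ[F,a,b], q ≠ 0 → IsUnit q) ↔ IsNormFormAnisotropic a b := by
  constructor
  · intro h x y z w hN
    by_contra hne
    have hq : (⟨x, y, z, w⟩ : ℍ[F,a,b]) ≠ 0 := fun h0 ↦ hne (QuaternionAlgebra.ext_iff.1 h0)
    have hstar := quaternion_mul_star (⟨x, y, z, w⟩ : ℍ[F,a,b])
    rw [hN, map_zero, (h _ hq).mul_right_eq_zero, star_eq_zero] at hstar
    exact hq hstar
  · intro h q hq
    have hN : q.re ^ 2 - a * q.imI ^ 2 - b * q.imJ ^ 2 + a * b * q.imK ^ 2 ≠ 0 := fun hN ↦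
      hq (QuaternionAlgebra.ext_iff.2 (h _ _ _ _ hN))
    have hu : IsUnit (q * star q) := by
      rw [quaternion_mul_star]
      exact hN.isUnit.map _
    have hcomm : Commute q (star q) := (star_comm_self' q).symm
    exact (hcomm.isUnit_mul_iff.1 hu).1

theorem HasQuaternionBasis.baseChange {D : Type*} [Ring D] [Algebra F D] {a b : F}
    (h : HasQuaternionBasis D a b) (K : Type*) [Field K] [Algebra F K] :
    HasQuaternionBasis (K ⊗[F] D) (algebraMap F K a) (algebraMap F K b) := by
  obtain ⟨i, j, hi, hj, hij⟩ := h.exists_anticommute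
  let f : D →ₐ[F] K ⊗[F] D := Algebra.TensorProduct.includeRight
  refine .of_anticommute (i := f i) (j := f j) ?_ ?_ ?_
  · rw [← map_mul, hi, f.commutes, ← IsScalarTower.algebraMap_apply]
  · rw [← map_mul, hj, f.commutes, ← IsScalarTower.algebraMap_apply]
  · rw [← map_mul, hij, map_neg, map_mul]

theorem isDivisionOver_iff {D : Type*} [Ring D] [Algebra ℚ D]
    (hD : Module.finrank ℚ D = 4) {a b : ℚ} (h : HasQuaternionBasis D a b) (ha : a ≠ 0)
    (hb : b ≠ 0) (K : Type*) [Field K] [Algebra ℚ K] :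
    IsDivisionOver K D ↔ IsNormFormAnisotropic (algebraMap ℚ K a) (algebraMap ℚ K b) := by
  have : CharZero K := algebraRat.charZero K
  have : Nontrivial D := Module.nontrivial_of_finrank_pos (R := ℚ) (by omega)
  have : FiniteDimensional ℚ D := Module.finite_of_finrank_eq_succ hD
  obtain ⟨q⟩ := h.baseChange K
  have hbij : Function.Bijective q.liftHom := liftHom_bijective_of_finrank_eq_four
    (by rw [Module.finrank_baseChange, hD]) q (by simpa using ha) (by simpa using hb)
  let e := AlgEquiv.ofBijective q.liftHom hbij
  rw [← forall_isUnit_quaternion_iff]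
  constructor
  · intro h x hx
    exact (isUnit_map_iff e x).1 (h (e x) (by simpa using hx))
  · intro h x hx
    exact (isUnit_map_iff e.symm x).1 (h (e.symm x) (by simpa using hx))

end QuaternionBases

section LocalNormForms

section Padic

variable {p : ℕ} [Fact p.Prime]

theorem exists_eq_mul_padicInt_of_ne_zero {ι : Type*} [Finite ι] {v : ι → ℚ_[p]} (hv : v ≠ 0) :
    ∃ (c : ℚ_[p]) (w : ι → ℤ_[p]), c ≠ 0 ∧ (∀ i, v i = c * w i) ∧ ∃ i, w i = 1 := by
  obtain ⟨k, hk⟩ := Function.ne_iff.1 hv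
  have : Nonempty ι := ⟨k⟩
  obtain ⟨m, hm⟩ := Finite.exists_max (‖v ·‖)
  have hvm : v m ≠ 0 := norm_pos_iff.1 ((norm_pos_iff.2 hk).trans_le (hm k))
  have hint (i : ι) : ‖v i / v m‖ ≤ 1 := by
    rw [norm_div]
    exact div_le_one_of_le₀ (hm i) (norm_nonneg _)
  exact ⟨v m, fun i ↦ ⟨v i / v m, hint i⟩, hvm, fun i ↦ (mul_div_cancel₀ (v i) hvm).symm, m,
    Subtype.ext (div_self hvm)⟩

theorem padicInt_toZMod_eq_zero_iff {x : ℤ_[p]} : PadicInt.toZMod x = 0 ↔ ‖x‖ < 1 := by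
  rw [← RingHom.mem_ker, PadicInt.ker_toZMod, IsLocalRing.mem_maximalIdeal, PadicInt.mem_nonunits]

theorem eq_zero_of_sq_add_mul_sq_eq_zero {F : Type*} [Field F] {c x z : F} (hc : ¬IsSquare (-c))
    (h : x ^ 2 + c * z ^ 2 = 0) : x = 0 ∧ z = 0 := by
  obtain rfl : z = 0 := by
    by_contra hz
    refine hc ⟨x / z, ?_⟩
    field_simp
    linear_combination -h
  simpa using h

theorem padicInt_norm_sq_add_mul_sq_eq_one {c : ℤ} (hc : ¬IsSquare (-(c : ZMod p))) {s t : ℤ_[p]}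
    (h : s = 1 ∨ t = 1) : ‖s ^ 2 + c * t ^ 2‖ = 1 := by
  by_contra hne
  have hlt : ‖s ^ 2 + c * t ^ 2‖ < 1 := lt_of_le_of_ne (PadicInt.norm_le_one _) hne
  rw [← padicInt_toZMod_eq_zero_iff, map_add, map_mul, map_pow, map_pow, map_intCast] at hlt
  obtain ⟨hs, ht⟩ := eq_zero_of_sq_add_mul_sq_eq_zero hc hlt
  rcases h with rfl | rfl <;> simp_all

/-- The values of `x² + c z²` have even valuation, since this form is anisotropic modulo `p`. -/
theorem exists_norm_sq_add_mul_sq_eq {c : ℤ} (hc : ¬IsSquare (-(c : ZMod p))) (x z : ℚ_[p]) :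
    ∃ M : ℚ_[p], ‖x ^ 2 + c * z ^ 2‖ = ‖M‖ ^ 2 ∧ (M = 0 → x = 0 ∧ z = 0) := by
  by_cases hv : ![x, z] = 0
  · obtain ⟨rfl, rfl⟩ : x = 0 ∧ z = 0 := by simpa using hv
    exact ⟨0, by simp⟩
  obtain ⟨M, w, hM, hw, hone⟩ := exists_eq_mul_padicInt_of_ne_zero hv
  obtain ⟨rfl, rfl⟩ : x = M * w 0 ∧ z = M * w 1 := ⟨hw 0, hw 1⟩
  refine ⟨M, ?_, fun h ↦ absurd h hM⟩
  have hnorm := padicInt_norm_sq_add_mul_sq_eq_one hc (Fin.exists_fin_two.1 hone)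
  rw [PadicInt.norm_def] at hnorm
  push_cast at hnorm
  rw [show (M * w 0) ^ 2 + c * (M * w 1) ^ 2 = M ^ 2 * (w 0 ^ 2 + c * w 1 ^ 2) by ring, norm_mul,
    hnorm, norm_pow, mul_one]

theorem eq_zero_of_norm_sq_eq_inv_mul_norm_sq {M N : ℚ_[p]}
    (h : ‖M‖ ^ 2 = (p : ℝ)⁻¹ * ‖N‖ ^ 2) : M = 0 ∧ N = 0 := by
  have hp : 1 < (p : ℝ) := by exact_mod_cast (Fact.out : p.Prime).one_lt
  have hiff : M = 0 ↔ N = 0 := by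
    rw [← norm_eq_zero, ← sq_eq_zero_iff, h]
    simp [(zero_lt_one.trans hp).ne']
  by_contra hne
  have hN : N ≠ 0 := by tauto
  have hM : M ≠ 0 := by tauto
  rw [Padic.norm_eq_zpow_neg_valuation hM, Padic.norm_eq_zpow_neg_valuation hN, ← zpow_neg_one,
    ← zpow_natCast, ← zpow_natCast, ← zpow_mul, ← zpow_mul, ← zpow_add₀ (by positivity)] at h
  have := zpow_right_injective₀ (by positivity) hp.ne' h
  push_cast at this
  omega

theorem isNormFormAnisotropic_padic_of_not_isSquare {c m : ℤ} (hc : ¬IsSquare (-(c : ZMod p)))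
    (hm : (p : ℤ) ∣ m) (hm' : ¬(p : ℤ) ^ 2 ∣ m) :
    IsNormFormAnisotropic (-m : ℚ_[p]) (-c : ℚ_[p]) := by
  obtain ⟨e, rfl⟩ := hm
  have he : ‖(e : ℚ_[p])‖ = 1 := by
    refine (Padic.norm_int_le_one e).antisymm (not_lt.1 fun hlt ↦ hm' ?_)
    rw [sq]
    exact mul_dvd_mul_left _ (Padic.norm_intCast_lt_one_iff.1 hlt)
  intro x y z w h
  obtain ⟨M, hM, hM0⟩ := exists_norm_sq_add_mul_sq_eq hc x z
  obtain ⟨N, hN, hN0⟩ := exists_norm_sq_add_mul_sq_eq hc y w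
  have hMN : ‖M‖ ^ 2 = (p : ℝ)⁻¹ * ‖N‖ ^ 2 := by
    have hxz : x ^ 2 + c * z ^ 2 = -((p : ℚ_[p]) * e * (y ^ 2 + c * w ^ 2)) := by
      push_cast at h
      linear_combination h
    rw [← hM, ← hN, hxz, norm_neg, norm_mul, norm_mul, he, Padic.norm_p, mul_one]
  obtain ⟨rfl, rfl⟩ := eq_zero_of_norm_sq_eq_inv_mul_norm_sq hMN
  obtain ⟨hx, hz⟩ := hM0 rfl
  obtain ⟨hy, hw⟩ := hN0 rfl
  exact ⟨hx, hy, hz, hw⟩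

theorem padicInt_exists_sq_eq {s a : ℤ_[p]} (h : ‖a ^ 2 - s‖ < ‖2 * a‖ ^ 2) :
    ∃ z : ℤ_[p], z ^ 2 = s := by
  obtain ⟨z, hz, -⟩ := hensels_lemma (F := Polynomial.X ^ 2 - Polynomial.C s) (a := a)
    (by simpa [one_add_one_eq_two] using h)
  exact ⟨z, by simpa [sub_eq_zero] using hz⟩

theorem padicInt_exists_sq_eq_of_toZMod (hp : p ≠ 2) {s a : ℤ_[p]}
    (ha : PadicInt.toZMod a ≠ 0) (h : PadicInt.toZMod a ^ 2 = PadicInt.toZMod s) :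
    ∃ z : ℤ_[p], z ^ 2 = s := by
  have hlt : ‖a ^ 2 - s‖ < 1 := by
    rw [← padicInt_toZMod_eq_zero_iff, map_sub, map_pow, h, sub_self]
  have h2 : (2 : ZMod p) ≠ 0 := Ring.two_ne_zero (by rwa [ZMod.ringChar_zmod_n])
  have hone : ‖2 * a‖ = 1 := by
    refine (PadicInt.norm_le_one _).antisymm (not_lt.1 fun hlt ↦ ?_)
    rw [← padicInt_toZMod_eq_zero_iff, map_mul, map_ofNat] at hlt
    exact mul_ne_zero h2 ha hlt
  exact padicInt_exists_sq_eq (by rwa [hone, one_pow])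

theorem padicInt_exists_sq_add_sq_eq (hp : p ≠ 2) {n : ℤ} (hn : ¬(p : ℤ) ∣ n) :
    ∃ x y : ℤ_[p], x ^ 2 + y ^ 2 = n := by
  obtain ⟨a, b, hab, ha⟩ : ∃ a b : ZMod p, a ^ 2 + b ^ 2 = n ∧ a ≠ 0 := by
    obtain ⟨a, b, hab⟩ := ZMod.sq_add_sq p (n : ZMod p)
    by_cases ha : a = 0
    · refine ⟨b, a, by rw [add_comm, hab], ?_⟩
      rintro rfl
      rw [ha] at hab
      exact hn ((ZMod.intCast_zmod_eq_zero_iff_dvd n p).1 (by simpa using hab.symm))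
    · exact ⟨a, b, hab, ha⟩
  obtain ⟨a, rfl⟩ := ZMod.ringHom_surjective PadicInt.toZMod a
  obtain ⟨b, rfl⟩ := ZMod.ringHom_surjective PadicInt.toZMod b
  obtain ⟨x, hx⟩ := padicInt_exists_sq_eq_of_toZMod hp (s := n - b ^ 2) ha <| by
    rw [map_sub, map_intCast, map_pow, ← hab, add_sub_cancel_right]
  exact ⟨x, b, by rw [hx, sub_add_cancel]⟩

theorem not_isNormFormAnisotropic_neg_one_padic (hp : p ≠ 2) {c : ℤ} (hc : ¬(p : ℤ) ∣ c) :
    ¬IsNormFormAnisotropic (-1 : ℚ_[p]) (-c : ℚ_[p]) := by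
  intro h
  obtain ⟨x, y, hxy⟩ := padicInt_exists_sq_add_sq_eq hp (n := -c) (by rwa [dvd_neg])
  have hxy' : (x : ℚ_[p]) ^ 2 + (y : ℚ_[p]) ^ 2 = -c := by exact_mod_cast congrArg _ hxy
  exact one_ne_zero (h x y 1 0 (by linear_combination hxy')).2.2.1

/-- A primitive zero of `x² + y² + z² + w²` would have a unit coordinate, which is impossible
modulo `8`. -/
theorem isNormFormAnisotropic_neg_one_neg_one_padic_two :
    IsNormFormAnisotropic (-1 : ℚ_[2]) (-1 : ℚ_[2]) := by
  have hmod : ∀ a b c : ZMod (2 ^ 3), 1 ^ 2 + (a ^ 2 + b ^ 2 + c ^ 2) ≠ 0 := by decide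
  intro x y z w h
  suffices ![x, y, z, w] = 0 by simpa using this
  by_contra hv
  obtain ⟨c, u, hc, hu, i, hi⟩ := exists_eq_mul_padicInt_of_ne_zero hv
  have hsum : ∑ j, u j ^ 2 = 0 := by
    obtain ⟨rfl, rfl, rfl, rfl⟩ : x = c * u 0 ∧ y = c * u 1 ∧ z = c * u 2 ∧ w = c * u 3 :=
      ⟨hu 0, hu 1, hu 2, hu 3⟩
    have : c ^ 2 * ((∑ j, u j ^ 2 : ℤ_[2]) : ℚ_[2]) = 0 := by
      rw [Fin.sum_univ_four]
      push_cast
      linear_combination h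
    exact Subtype.ext ((mul_eq_zero.1 this).resolve_left (pow_ne_zero 2 hc))
  rw [Fin.sum_univ_succAbove _ i, Fin.sum_univ_three, hi] at hsum
  have hzero := congrArg (PadicInt.toZModPow 3) hsum
  simp only [map_add, map_pow, map_one, map_zero] at hzero
  exact hmod _ _ _ hzero

/-- The norm form represents zero at `(√-15, 0, 1, 2)`. -/
theorem not_isNormFormAnisotropic_neg_one_neg_three_padic_two :
    ¬IsNormFormAnisotropic (-1 : ℚ_[2]) (-3 : ℚ_[2]) := by
  intro h
  obtain ⟨x, hx⟩ : ∃ x : ℤ_[2], x ^ 2 = -15 := by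
    refine padicInt_exists_sq_eq (a := 1) ?_
    have hdiff : (1 : ℤ_[2]) ^ 2 - -15 = (2 : ℕ) ^ 4 := by norm_num
    have hderiv : (2 * 1 : ℤ_[2]) = (2 : ℕ) := by norm_num
    rw [hdiff, hderiv, norm_pow, PadicInt.norm_p]
    norm_num
  have hx' : (x : ℚ_[2]) ^ 2 = -15 := by exact_mod_cast congrArg _ hx
  exact one_ne_zero (h x 0 1 2 (by linear_combination hx')).2.2.1

end Padic

theorem isNormFormAnisotropic_real_iff {a b : ℝ} :
    IsNormFormAnisotropic a b ↔ a < 0 ∧ b < 0 := by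
  constructor
  · intro h
    constructor
    · by_contra! ha
      exact one_ne_zero (h √a 1 0 0 (by rw [Real.sq_sqrt ha]; ring)).2.1
    · by_contra! hb
      exact one_ne_zero (h √b 0 1 0 (by rw [Real.sq_sqrt hb]; ring)).2.2.1
  · rintro ⟨ha, hb⟩ x y z w h
    have hx := sq_nonneg x
    have hy := mul_nonneg (neg_pos.2 ha).le (sq_nonneg y)
    have hz := mul_nonneg (neg_pos.2 hb).le (sq_nonneg z)
    have hw := mul_nonneg (mul_pos_of_neg_of_neg ha hb).le (sq_nonneg w)
    have hx0 : x ^ 2 = 0 := by linarith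
    have hy0 : a * y ^ 2 = 0 := by linarith
    have hz0 : b * z ^ 2 = 0 := by linarith
    have hw0 : a * b * w ^ 2 = 0 := by linarith
    simp only [mul_eq_zero, sq_eq_zero_iff, ha.ne, hb.ne, false_or] at hx0 hy0 hz0 hw0
    exact ⟨hx0, hy0, hz0, hw0⟩

end LocalNormForms

section Reduction

theorem exists_int_two_mul_add_mul_mem_Icc {a : ℤ} (ha : 0 < a) (b : ℤ) :
    ∃ k, 2 * (b + k * a) ∈ Set.Icc (-a) a := by
  refine ⟨-((2 * b + a) / (2 * a)), ?_⟩
  have hnonneg := Int.emod_nonneg (2 * b + a) (b := 2 * a) (by omega)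
  have hlt := Int.emod_lt_of_pos (2 * b + a) (b := 2 * a) (by omega)
  have hdiv := Int.emod_add_mul_ediv (2 * b + a) (2 * a)
  constructor <;> linarith

theorem exists_int_four_mul_sq_add_mul_le {a : ℤ} (ha : 0 < a) (b : ℤ) :
    ∃ k, 4 * (b + k * a) ^ 2 ≤ a ^ 2 := by
  obtain ⟨k, hk⟩ := exists_int_two_mul_add_mul_mem_Icc ha b
  exact ⟨k, by nlinarith [hk.1, hk.2]⟩

/-- The integral binary quadratic form `a x² + 2 b x y + c y²`. -/
structure BinaryForm where
  (a b c : ℤ)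

namespace BinaryForm

/-- The value of a binary form at `(x, y)`. -/
def eval (q : BinaryForm) (x y : ℤ) : ℤ :=
  q.a * x ^ 2 + 2 * q.b * x * y + q.c * y ^ 2

/-- The determinant of the Gram matrix of a binary form. -/
def det (q : BinaryForm) : ℤ :=
  q.a * q.c - q.b ^ 2

/-- Positive definiteness of a binary form, by Sylvester's criterion. -/
def IsPosDef (q : BinaryForm) : Prop :=
  0 < q.a ∧ 0 < q.det

/-- The binary form obtained by the substitution `(x, y) ↦ (k x - y, x)`: the shear by `k`,
followed by exchanging the variables. -/
def shearSwap (q : BinaryForm) (k : ℤ) : BinaryForm :=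
  ⟨q.eval k 1, -(q.b + k * q.a), q.a⟩

theorem det_shearSwap (q : BinaryForm) (k : ℤ) : (q.shearSwap k).det = q.det := by
  simp only [det, shearSwap, eval]; ring

theorem eval_shearSwap (q : BinaryForm) (k x y : ℤ) :
    (q.shearSwap k).eval x y = q.eval (k * x - y) x := by
  simp only [eval, shearSwap]; ring

theorem IsPosDef.shearSwap {q : BinaryForm} (hq : q.IsPosDef) (k : ℤ) :
    (q.shearSwap k).IsPosDef := by
  refine ⟨?_, (q.det_shearSwap k).symm ▸ hq.2⟩
  have hmul : q.a * q.eval k 1 = (q.b + k * q.a) ^ 2 + q.det := by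
    simp only [eval, det]; ring
  have hdet := hq.2
  have hpos : 0 < q.a * q.eval k 1 := by rw [hmul]; positivity
  exact pos_of_mul_pos_right hpos hq.1.le

theorem IsPosDef.exists_isCoprime_three_mul_sq_le {q : BinaryForm} (hq : q.IsPosDef) :
    ∃ x y, IsCoprime x y ∧ 0 < q.eval x y ∧ 3 * q.eval x y ^ 2 ≤ 4 * q.det := by
  induction hn : q.a.toNat using Nat.strong_induction_on generalizing q with
  | _ n ih =>
    obtain ⟨k, hk⟩ := exists_int_four_mul_sq_add_mul_le hq.1 q.b
    have hmul : q.a * q.eval k 1 = (q.b + k * q.a) ^ 2 + q.det := by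
      simp only [eval, det]; ring
    rcases le_or_gt q.a (q.eval k 1) with hle | hlt
    · refine ⟨1, 0, isCoprime_one_left, by simpa [eval] using hq.1, ?_⟩
      have hsq : q.a ^ 2 ≤ q.a * q.eval k 1 := by
        rw [sq]; exact mul_le_mul_of_nonneg_left hle hq.1.le
      simp only [eval, one_pow, mul_one, mul_zero, add_zero, zero_pow two_ne_zero]
      linarith
    · have hq' := hq.shearSwap k
      have ha : 0 < q.eval k 1 := hq'.1
      have hlt' : (q.shearSwap k).a.toNat < n := by
        simp only [BinaryForm.shearSwap]; omega
      obtain ⟨x, y, hxy, hpos, hle⟩ := ih _ hlt' hq' rfl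
      rw [eval_shearSwap, det_shearSwap] at hle
      rw [eval_shearSwap] at hpos
      refine ⟨k * x - y, x, ?_, hpos, hle⟩
      rw [sub_eq_neg_add, IsCoprime.add_mul_right_left_iff, IsCoprime.neg_left_iff]
      exact hxy.symm

end BinaryForm

/-- The integral ternary quadratic form
`a x² + b y² + c z² + 2 e y z + 2 f x z + 2 g x y`. -/
structure TernaryForm where
  (a b c e f g : ℤ)

namespace TernaryForm

/-- The value of a ternary form at `(x, y, z)`. -/
def eval (q : TernaryForm) (x y z : ℤ) : ℤ :=
  q.a * x ^ 2 + q.b * y ^ 2 + q.c * z ^ 2 + 2 * q.e * y * z + 2 * q.f * x * z + 2 * q.g * x * y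

/-- The determinant of the Gram matrix of a ternary form. -/
def det (q : TernaryForm) : ℤ :=
  q.a * q.b * q.c + 2 * q.e * q.f * q.g - q.a * q.e ^ 2 - q.b * q.f ^ 2 - q.c * q.g ^ 2

/-- The binary form `r` left over by completing the square in the first variable:
`a q(x, y, z) = (a x + g y + f z)² + r(y, z)`. -/
def residual (q : TernaryForm) : BinaryForm :=
  ⟨q.a * q.b - q.g ^ 2, q.a * q.e - q.f * q.g, q.a * q.c - q.f ^ 2⟩

/-- Positive definiteness of a ternary form, expressed through the residual binary form. -/
def IsPosDef (q : TernaryForm) : Prop :=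
  0 < q.a ∧ q.residual.IsPosDef

theorem det_residual (q : TernaryForm) : q.residual.det = q.a * q.det := by
  simp only [residual, BinaryForm.det, det]; ring

theorem isPosDef_iff {q : TernaryForm} : q.IsPosDef ↔ 0 < q.a ∧ 0 < q.residual.a ∧ 0 < q.det := by
  refine and_congr_right fun ha ↦ and_congr_right fun _ ↦ ?_
  rw [det_residual, mul_pos_iff_of_pos_left ha]

/-- The ternary form obtained by the substitution
`(x, y, z) ↦ (y + k x, p x + r z, s x + t z)`. -/
def subst (q : TernaryForm) (k p r s t : ℤ) : TernaryForm where
  a := q.eval k p s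
  b := q.a
  c := q.eval 0 r t
  e := q.g * r + q.f * t
  f := q.b * p * r + q.e * (p * t + r * s) + q.c * s * t + k * (q.g * r + q.f * t)
  g := q.g * p + q.f * s + k * q.a

theorem eval_subst (q : TernaryForm) (k p r s t x y z : ℤ) :
    (q.subst k p r s t).eval x y z = q.eval (y + k * x) (p * x + r * z) (s * x + t * z) := by
  simp only [eval, subst]; ring

theorem det_subst (q : TernaryForm) (k p r s t : ℤ) :
    (q.subst k p r s t).det = q.det * (p * t - r * s) ^ 2 := by
  simp only [det, subst, eval]; ring

theorem residual_subst_a (q : TernaryForm) (k p r s t : ℤ) :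
    (q.subst k p r s t).residual.a = q.residual.eval p s := by
  simp only [residual, BinaryForm.eval, subst, eval]; ring

/-- One step of Hermite reduction: `(p, s)` makes the residual form small at `(1, 0)`, and the shear
by `k` then reduces `g` modulo `a`. -/
theorem IsPosDef.exists_subst {q : TernaryForm} (hq : q.IsPosDef) :
    ∃ k p r s t, (q.subst k p r s t).IsPosDef ∧ (q.subst k p r s t).det = q.det ∧
      4 * (q.subst k p r s t).g ^ 2 ≤ q.a ^ 2 ∧
      3 * (q.subst k p r s t).residual.a ^ 2 ≤ 4 * (q.a * q.det) := by
  obtain ⟨p, s, ⟨t, r, hdet⟩, hpos, hle⟩ := hq.2.exists_isCoprime_three_mul_sq_le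
  obtain ⟨k, hk⟩ := exists_int_four_mul_sq_add_mul_le hq.1 (q.g * p + q.f * s)
  have hdet' : (q.subst k p (-r) s t).det = q.det := by
    rw [det_subst, show p * t - -r * s = 1 by linear_combination hdet, one_pow, mul_one]
  have hres := q.residual_subst_a k p (-r) s t
  have hmul : q.a * (q.subst k p (-r) s t).a =
      (q.subst k p (-r) s t).residual.a + (q.subst k p (-r) s t).g ^ 2 := by
    simp only [residual, subst]; ring
  refine ⟨k, p, -r, s, t, isPosDef_iff.2 ⟨?_, hres ▸ hpos, ?_⟩, hdet', hk, ?_⟩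
  · exact pos_of_mul_pos_right (by rw [hmul, hres]; positivity) hq.1.le
  · exact hdet' ▸ (isPosDef_iff.1 hq).2.2
  · rw [hres, ← det_residual]
    exact hle

theorem twenty_seven_mul_cube_le_of_le {a b m g d : ℤ} (ha : 0 < a) (hab : a ≤ b)
    (hm : a * b = m + g ^ 2) (hg : 4 * g ^ 2 ≤ a ^ 2) (hmd : 3 * m ^ 2 ≤ 4 * (a * d)) :
    27 * a ^ 3 ≤ 64 * d := by
  have hsq : a ^ 2 ≤ a * b := by
    rw [sq]; exact mul_le_mul_of_nonneg_left hab ha.le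
  have hle : 3 * a ^ 2 ≤ 4 * m := by linarith
  have hmul : a * (27 * a ^ 3) ≤ a * (64 * d) := calc
    a * (27 * a ^ 3) = 3 * (3 * a ^ 2) ^ 2 := by ring
    _ ≤ 3 * (4 * m) ^ 2 := by gcongr
    _ = 16 * (3 * m ^ 2) := by ring
    _ ≤ 16 * (4 * (a * d)) := by gcongr
    _ = a * (64 * d) := by ring
  exact le_of_mul_le_mul_left hmul ha

theorem IsPosDef.exists_eval_cube_le {q : TernaryForm} (hq : q.IsPosDef) :
    ∃ x y z, 0 < q.eval x y z ∧ 27 * q.eval x y z ^ 3 ≤ 64 * q.det := by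
  induction hn : q.a.toNat using Nat.strong_induction_on generalizing q with
  | _ n ih =>
    obtain ⟨k, p, r, s, t, hq', hdet, hg, hres⟩ := hq.exists_subst
    have ha := hq.1
    have ha' := hq'.1
    rcases le_or_gt q.a (q.subst k p r s t).a with hle | hlt
    · have hmul : q.a * (q.subst k p r s t).a =
          (q.subst k p r s t).residual.a + (q.subst k p r s t).g ^ 2 := by
        simp only [residual, subst]; ring
      have heval : q.eval 1 0 0 = q.a := by simp [eval]
      exact ⟨1, 0, 0, heval.symm ▸ ha, heval.symm ▸
        twenty_seven_mul_cube_le_of_le ha hle hmul hg hres⟩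
    · obtain ⟨x, y, z, hpos, hle⟩ := ih _ (by omega) hq' rfl
      rw [hdet] at hle
      rw [eval_subst] at hpos hle
      exact ⟨_, _, _, hpos, hle⟩

end TernaryForm

end Reduction

section TernaryEquations

theorem exists_dvd_sub_and_dvd_sub {R : Type*} [CommRing R] {m n : R} (h : IsCoprime m n)
    (a b : R) : ∃ x, m ∣ x - a ∧ n ∣ x - b := by
  obtain ⟨s, t, hst⟩ := h
  exact ⟨a * (t * n) + b * (s * m), ⟨(b - a) * s, by linear_combination a * hst⟩,
    ⟨(a - b) * t, by linear_combination b * hst⟩⟩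

theorem isSquare_intCast_zmod_of_squarefree {n : ℕ} (hn : Squarefree n) {m : ℤ}
    (h : ∀ p : ℕ, p.Prime → p ∣ n → IsSquare (m : ZMod p)) : IsSquare (m : ZMod n) := by
  induction n using induction_on_primes with
  | zero => exact absurd hn not_squarefree_zero
  | one => exact ⟨0, Subsingleton.elim _ _⟩
  | prime_mul p k hp ih =>
    obtain ⟨hcop, -, hk⟩ := Nat.squarefree_mul_iff.1 hn
    obtain ⟨x, hx⟩ := h p hp (dvd_mul_right p k)
    obtain ⟨y, hy⟩ := ih hk fun q hq hqk ↦ h q hq (hqk.mul_left p)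
    have hprod : IsSquare (m : ZMod p × ZMod k) := ⟨(x, y), Prod.ext hx hy⟩
    simpa only [map_intCast] using hprod.map (ZMod.chineseRemainder hcop).symm

theorem exists_dvd_mul_sq_add {n : ℕ} (hn : Squarefree n) {v w : ℤ} (hw : IsCoprime (n : ℤ) w)
    (h : ∀ p : ℕ, p.Prime → p ∣ n → IsSquare ((-(v * w) : ℤ) : ZMod p)) :
    ∃ α : ℤ, (n : ℤ) ∣ w * α ^ 2 + v := by
  obtain ⟨r, hr⟩ := isSquare_intCast_zmod_of_squarefree hn h
  obtain ⟨s, rfl⟩ := ZMod.intCast_surjective r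
  obtain ⟨x, y, hxy⟩ := hw
  have hinv : (y * w : ZMod n) = 1 := by
    simpa using congrArg (Int.cast : ℤ → ZMod n) hxy
  refine ⟨s * y, (ZMod.intCast_zmod_eq_zero_iff_dvd _ n).1 ?_⟩
  push_cast at hr ⊢
  linear_combination -(w * y ^ 2 : ZMod n) * hr - (v * (y * w + 1) : ZMod n) * hinv

variable {u v w e : ℤ}

theorem exists_dvd_and_mul_dvd (huv : IsCoprime u v) (huw : IsCoprime u w) (hvw : IsCoprime v w)
    {α β γ : ℤ} (hα : u ∣ w * α ^ 2 + v) (hβ : v ∣ w * β ^ 2 + e * u)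
    (hγ : w ∣ e * u * γ ^ 2 + v) :
    ∃ a b, u ∣ a ∧ v ∣ b ∧ u * v ∣ w * a ^ 2 + e * u ∧
      u * v * w ∣ w * (a * γ + b) ^ 2 + e * u * γ ^ 2 + v := by
  obtain ⟨a, hua, hva⟩ := exists_dvd_sub_and_dvd_sub huv 0 β
  obtain ⟨b, hub, hvb⟩ := exists_dvd_sub_and_dvd_sub huv α 0
  rw [sub_zero] at hua hvb
  have ha : v ∣ w * a ^ 2 + e * u := by
    rw [show w * a ^ 2 + e * u = (a - β) * (w * (a + β)) + (w * β ^ 2 + e * u) by ring]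
    exact dvd_add (hva.mul_right _) hβ
  have hb : u ∣ w * b ^ 2 + v := by
    rw [show w * b ^ 2 + v = (b - α) * (w * (b + α)) + (w * α ^ 2 + v) by ring]
    exact dvd_add (hub.mul_right _) hα
  refine ⟨a, b, hua, hvb, huv.mul_dvd ?_ ha, (huw.mul_left hvw).mul_dvd (huv.mul_dvd ?_ ?_) ?_⟩
  · exact dvd_add ((hua.pow two_ne_zero).mul_left w) (dvd_mul_left u e)
  · rw [show w * (a * γ + b) ^ 2 + e * u * γ ^ 2 + v =
      a * (w * γ * (a * γ + 2 * b)) + u * (e * γ ^ 2) + (w * b ^ 2 + v) by ring]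
    exact dvd_add (dvd_add (hua.mul_right _) (dvd_mul_right u _)) hb
  · rw [show w * (a * γ + b) ^ 2 + e * u * γ ^ 2 + v =
      (w * a ^ 2 + e * u) * γ ^ 2 + b * (w * (2 * a * γ + b)) + v by ring]
    exact dvd_add (dvd_add (ha.mul_right _) (hvb.mul_right _)) dvd_rfl
  · rw [add_assoc]
    exact dvd_add (dvd_mul_right w _) hγ

/-- The substitution has determinant `uvw` and the diagonal form has determinant `euvw`, so the
quotient form has determinant `(euvw)(uvw)² / (uvw)³ = e`. -/
theorem exists_ternaryForm_eval_eq (hu : 0 < u) (hv : 0 < v) (hw : 0 < w) (he : 0 < e)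
    {a b γ : ℤ} (hua : u ∣ a) (hvb : v ∣ b) (ha : u * v ∣ w * a ^ 2 + e * u)
    (hb : u * v * w ∣ w * (a * γ + b) ^ 2 + e * u * γ ^ 2 + v) :
    ∃ Q : TernaryForm, Q.IsPosDef ∧ Q.det = e ∧ ∀ x y z,
      w * (u * v * x + a * w * y + (a * γ + b) * z) ^ 2 + e * u * (w * y + γ * z) ^ 2 + v * z ^ 2 =
        u * v * w * Q.eval x y z := by
  obtain ⟨d, hd⟩ := mul_dvd_mul hua hvb
  obtain ⟨t, ht⟩ := ha
  obtain ⟨c, hc⟩ := hb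
  let Q : TernaryForm := ⟨u * v, w * t, c, t * γ + d * w, a * γ + b, a * w⟩
  have hres_a : Q.residual.a = w * (e * u) := by
    simp only [Q, TernaryForm.residual]
    linear_combination -w * ht
  have hres_b : Q.residual.b = e * u * γ := by
    simp only [Q, TernaryForm.residual]
    linear_combination -γ * ht - w * hd
  have hres_c : w * Q.residual.c = e * u * γ ^ 2 + v := by
    simp only [Q, TernaryForm.residual]
    linear_combination -hc
  have hdet : Q.det = e := by
    have hQ : u * v * Q.det = u * v * e := by
      change Q.a * Q.det = u * v * e
      rw [← TernaryForm.det_residual, BinaryForm.det, hres_a, hres_b]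
      linear_combination e * u * hres_c
    exact mul_left_cancel₀ (mul_pos hu hv).ne' hQ
  refine ⟨Q, TernaryForm.isPosDef_iff.2 ⟨mul_pos hu hv, ?_, hdet ▸ he⟩, hdet, fun x y z ↦ ?_⟩
  · rw [hres_a]; positivity
  · simp only [Q, TernaryForm.eval]
    linear_combination (w ^ 2 * y ^ 2 + 2 * w * γ * y * z) * ht + 2 * w ^ 2 * y * z * hd +
      z ^ 2 * hc

theorem exists_mul_sq_add_eq_mul_mul (hu : 0 < u) (hv : 0 < v) (hw : 0 < w) (he : 0 < e)
    (he3 : e ≤ 3) (huv : IsCoprime u v) (huw : IsCoprime u w) (hvw : IsCoprime v w) {α β γ : ℤ}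
    (hα : u ∣ w * α ^ 2 + v) (hβ : v ∣ w * β ^ 2 + e * u) (hγ : w ∣ e * u * γ ^ 2 + v) :
    ∃ X Y Z : ℤ, w * X ^ 2 + e * u * Y ^ 2 + v * Z ^ 2 = u * v * w := by
  obtain ⟨a, b, hua, hvb, ha, hb⟩ := exists_dvd_and_mul_dvd huv huw hvw hα hβ hγ
  obtain ⟨Q, hQ, hdet, heval⟩ := exists_ternaryForm_eval_eq hu hv hw he hua hvb ha hb
  obtain ⟨x, y, z, hpos, hle⟩ := hQ.exists_eval_cube_le
  have hone : Q.eval x y z = 1 := by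
    by_contra hne
    have htwo : 2 ≤ Q.eval x y z := by omega
    have hcube : 2 ^ 3 ≤ Q.eval x y z ^ 3 := by gcongr
    omega
  exact ⟨_, _, _, by rw [heval x y z, hone, mul_one]⟩

theorem exists_eq_sq_add_three_mul_sq {n : ℕ} (hn : Odd n) {s : ℤ} (h : (n : ℤ) ∣ s ^ 2 + 3) :
    ∃ x y : ℤ, (n : ℤ) = x ^ 2 + 3 * y ^ 2 := by
  obtain ⟨c, hc⟩ := h
  let q : BinaryForm := ⟨n, s, c⟩
  have hdet : q.det = 3 := by
    simp only [q, BinaryForm.det]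
    linear_combination -hc
  obtain ⟨x, y, -, hpos, hle⟩ := BinaryForm.IsPosDef.exists_isCoprime_three_mul_sq_le (q := q)
    ⟨Nat.cast_pos.2 hn.pos, hdet ▸ three_pos⟩
  have hmul : n * q.eval x y = (n * x + s * y) ^ 2 + 3 * y ^ 2 := by
    simp only [q, BinaryForm.eval]
    linear_combination -y ^ 2 * hc
  have hlt : q.eval x y < 3 := by nlinarith
  obtain hone | htwo : q.eval x y = 1 ∨ q.eval x y = 2 := by omega
  · exact ⟨_, _, by rw [← hmul, hone, mul_one]⟩
  · obtain ⟨k, rfl⟩ := hn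
    have hmod : ∀ x y : ZMod 4, x ^ 2 + 3 * y ^ 2 ≠ 2 := by decide
    have hfour : (4 : ZMod 4) = 0 := rfl
    rw [htwo] at hmul
    have hcast := congrArg (Int.cast : ℤ → ZMod 4) hmul
    push_cast at hcast
    exact absurd (hcast.symm.trans (by linear_combination (k : ZMod 4) * hfour)) (hmod _ _)

theorem exists_squarefree_mul_sq_eq {q : ℚ} (hq : 0 < q) :
    ∃ (n : ℕ) (r : ℚ), Squarefree n ∧ q * r ^ 2 = n := by
  obtain ⟨k, hk⟩ := Int.eq_ofNat_of_zero_le (Rat.num_nonneg.2 hq.le)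
  have hk0 : 0 < k := by
    have hnum := Rat.num_pos.2 hq
    omega
  obtain ⟨n, b, -, hb, hnb, hn⟩ := Nat.sq_mul_squarefree_of_pos (Nat.mul_pos hk0 q.den_pos)
  have hnb' : (b ^ 2 * n : ℚ) = q * q.den ^ 2 := by
    rw [sq (q.den : ℚ), ← mul_assoc, Rat.mul_den_eq_num, hk]
    exact_mod_cast hnb
  have hb' : (b : ℚ) ≠ 0 := Nat.cast_ne_zero.2 hb.ne'
  refine ⟨n, q.den / b, hn, ?_⟩
  rw [div_pow, mul_div_assoc', ← hnb', mul_div_cancel_left₀ _ (pow_ne_zero 2 hb')]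

end TernaryEquations

section LocalGlobal

section Transformations

variable {F : Type*} [Field F] {A : Type*} [Ring A] [Algebra F A] {a b : F}

theorem HasQuaternionBasis.swap (h : HasQuaternionBasis A a b) : HasQuaternionBasis A b a := by
  obtain ⟨i, j, hi, hj, hij⟩ := h.exists_anticommute
  exact .of_anticommute hj hi (by rw [hij, neg_neg])

theorem HasQuaternionBasis.mul_norm (h : HasQuaternionBasis A a b) (x y : F) :
    HasQuaternionBasis A a (b * (x ^ 2 - a * y ^ 2)) := by
  obtain ⟨q⟩ := h
  refine (HasQuaternionBasis.of_anticommute (A := ℍ[F,a,b]) (i := ⟨0, 1, 0, 0⟩)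
    (j := ⟨0, 0, x, y⟩) ?_ ?_ ?_).map q.liftHom <;>
  ext <;> simp [QuaternionAlgebra.algebraMap_eq] <;> ring

theorem HasQuaternionBasis.mul_sq (h : HasQuaternionBasis A a b) (x : F) :
    HasQuaternionBasis A a (b * x ^ 2) := by
  simpa using h.mul_norm x 0

theorem HasQuaternionBasis.of_mul_norm {x y n : F} (h : HasQuaternionBasis A a (b * n))
    (hn : n ≠ 0) (hxy : n = x ^ 2 - a * y ^ 2) : HasQuaternionBasis A a b := by
  have hb : b * n * ((x / n) ^ 2 - a * (y / n) ^ 2) = b := by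
    rw [show (x / n) ^ 2 - a * (y / n) ^ 2 = (x ^ 2 - a * y ^ 2) / n ^ 2 by ring, ← hxy]
    field_simp
  exact hb ▸ h.mul_norm (x / n) (y / n)

theorem HasQuaternionBasis.exists_mul_self_eq (h : HasQuaternionBasis A a b) (x y z : F) :
    ∃ i : A, i * i = algebraMap F A (a * x ^ 2 + b * y ^ 2 - a * b * z ^ 2) := by
  obtain ⟨q⟩ := h
  refine ⟨q.liftHom ⟨0, x, y, z⟩, ?_⟩
  rw [← map_mul, ← AlgHom.commutes q.liftHom]
  congr 1
  ext <;> simp [QuaternionAlgebra.algebraMap_eq] <;> ring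

/-- With `s² = -3` and `t² = -2` anticommuting, `(s + st) / 3` and `(-2s + 3t + st) / 6` are
anticommuting square roots of `-1`. -/
theorem HasQuaternionBasis.neg_one_neg_one_of_neg_three_neg_two [CharZero F]
    (h : HasQuaternionBasis A (-3 : F) (-2)) : HasQuaternionBasis A (-1 : F) (-1) := by
  obtain ⟨q⟩ := h
  refine (HasQuaternionBasis.of_anticommute (A := ℍ[F,-3,-2]) (i := ⟨0, 1 / 3, 0, 1 / 3⟩)
    (j := ⟨0, -1 / 3, 1 / 2, 1 / 6⟩) ?_ ?_ ?_).map q.liftHom <;>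
  ext <;> simp [QuaternionAlgebra.algebraMap_eq] <;> norm_num

end Transformations

section Definite

variable {D : Type*} [Ring D] [Algebra ℚ D]

theorem neg_of_isDivisionOver_real (hD : Module.finrank ℚ D = 4) {a b : ℚ}
    (h : HasQuaternionBasis D a b) (ha : a ≠ 0) (hb : b ≠ 0) (hinf : IsDivisionOver ℝ D) :
    a < 0 ∧ b < 0 := by
  simpa [isDivisionOver_iff hD h ha hb, isNormFormAnisotropic_real_iff] using hinf

theorem HasQuaternionBasis.exists_squarefree {A : Type*} [Ring A] [Algebra ℚ A] {a b : ℚ}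
    (h : HasQuaternionBasis A a b) (hb : b < 0) :
    ∃ n : ℕ, Squarefree n ∧ HasQuaternionBasis A a (-n) := by
  obtain ⟨n, r, hn, hr⟩ := exists_squarefree_mul_sq_eq (neg_pos.2 hb)
  refine ⟨n, hn, ?_⟩
  rw [← hr, neg_mul, neg_neg]
  exact h.mul_sq r

/-- `D` is split at all primes other than `2` and `3`. -/
def IsSplitAwayFromTwoThree (D : Type*) [Ring D] [Algebra ℚ D] : Prop :=
  ∀ (p : ℕ) [Fact p.Prime], p ≠ 2 → p ≠ 3 → ¬IsDivisionOver ℚ_[p] D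

theorem IsSplitAwayFromTwoThree.isSquare_neg (hsplit : IsSplitAwayFromTwoThree D)
    (hD : Module.finrank ℚ D = 4) {m c : ℕ} (hq : HasQuaternionBasis D (-m : ℚ) (-c))
    (hm : Squarefree m) (hc : c ≠ 0) {p : ℕ} (hp : p.Prime) (hpm : p ∣ m) (hp3 : p ≠ 3) :
    IsSquare (-(c : ZMod p)) := by
  rcases eq_or_ne p 2 with rfl | hp2
  · have hsquare : ∀ x : ZMod 2, IsSquare x := by decide
    exact hsquare _
  have : Fact p.Prime := ⟨hp⟩
  by_contra hc'
  have hpm' : ¬p ^ 2 ∣ m := by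
    rw [sq]
    exact fun h ↦ hp.not_isUnit (hm p h)
  have haniso := isNormFormAnisotropic_padic_of_not_isSquare (p := p) (c := c) (m := m)
    (by exact_mod_cast hc') (by exact_mod_cast hpm) (by exact_mod_cast hpm')
  refine hsplit p hp2 hp3 ((isDivisionOver_iff hD hq ?_ ?_ _).2 (by simpa using haniso))
  · simpa using hm.ne_zero
  · simpa using hc

theorem IsSplitAwayFromTwoThree.exists_dvd_mul_sq_add (hsplit : IsSplitAwayFromTwoThree D)
    (hD : Module.finrank ℚ D = 4) {m n v w : ℕ}
    (hq : HasQuaternionBasis D (-m : ℚ) (-(v * w : ℕ))) (hm : Squarefree m) (hv : v ≠ 0)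
    (hw : w ≠ 0) (hnm : n ∣ m) (hn3 : ¬3 ∣ n) (hnw : n.Coprime w) :
    ∃ α : ℤ, (n : ℤ) ∣ w * α ^ 2 + v := by
  refine _root_.exists_dvd_mul_sq_add (hm.squarefree_of_dvd hnm)
    (Nat.isCoprime_iff_coprime.2 hnw) fun p hp hpn ↦ ?_
  have hsquare := hsplit.isSquare_neg hD hq hm (mul_ne_zero hv hw) hp (hpn.trans hnm)
    (by rintro rfl; exact hn3 hpn)
  simpa only [Nat.cast_mul, Int.cast_neg, Int.cast_mul, Int.cast_natCast] using hsquare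

theorem IsSplitAwayFromTwoThree.exists_dvd_of_squarefree (hsplit : IsSplitAwayFromTwoThree D)
    (hD : Module.finrank ℚ D = 4) {u v w e : ℕ}
    (hq : HasQuaternionBasis D (-(e * u * v : ℕ) : ℚ) (-(v * w : ℕ)))
    (hsq : Squarefree (e * u * v * w)) (h3 : ¬3 ∣ u * v * w) :
    ∃ α β γ : ℤ, (u : ℤ) ∣ w * α ^ 2 + v ∧ (v : ℤ) ∣ w * β ^ 2 + e * u ∧
      (w : ℤ) ∣ e * u * γ ^ 2 + v := by
  obtain ⟨hcop, hsq', -⟩ := Nat.squarefree_mul_iff.1 hsq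
  have hvw : v.Coprime w := hcop.coprime_mul_left
  have heuw : (e * u).Coprime w := hcop.coprime_mul_right
  obtain ⟨heuv0, hw⟩ := mul_ne_zero_iff.1 hsq.ne_zero
  obtain ⟨heu, hv⟩ := mul_ne_zero_iff.1 heuv0
  have hv' : (v : ℚ) ≠ 0 := Nat.cast_ne_zero.2 hv
  have hq' : HasQuaternionBasis D (-(e * u * v : ℕ) : ℚ) (-(e * u * w : ℕ)) := by
    convert hq.mul_norm 0 (1 / v) using 1
    push_cast; field_simp; ring
  have hq'' : HasQuaternionBasis D (-(v * w : ℕ) : ℚ) (-(v * (e * u) : ℕ)) := by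
    rw [mul_comm v (e * u)]
    exact hq.swap
  obtain ⟨α, hα⟩ := hsplit.exists_dvd_mul_sq_add hD hq hsq' hv hw
    (dvd_mul_of_dvd_left (dvd_mul_left u e) v) (fun h ↦ h3 ((h.mul_right v).mul_right w))
    heuw.coprime_mul_left
  obtain ⟨β, hβ⟩ := hsplit.exists_dvd_mul_sq_add hD hq' hsq' heu hw (dvd_mul_left v _)
    (fun h ↦ h3 ((h.mul_left u).mul_right w)) hvw
  obtain ⟨γ, hγ⟩ := hsplit.exists_dvd_mul_sq_add hD hq''
    (hsq.squarefree_of_dvd ⟨e * u, by ring⟩) hv heu (dvd_mul_left w v) (fun h ↦ h3 (h.mul_left _))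
    heuw.symm
  exact ⟨α, β, γ, hα, by exact_mod_cast hβ, by exact_mod_cast hγ⟩

theorem IsSplitAwayFromTwoThree.exists_mul_self_eq_neg (hsplit : IsSplitAwayFromTwoThree D)
    (hD : Module.finrank ℚ D = 4) {u v w e : ℕ}
    (hq : HasQuaternionBasis D (-(e * u * v : ℕ) : ℚ) (-(v * w : ℕ)))
    (hsq : Squarefree (e * u * v * w)) (he : e ≤ 3) (h3 : ¬3 ∣ u * v * w) :
    ∃ i : D, i * i = algebraMap ℚ D (-e) := by
  obtain ⟨hceuv, hsq', -⟩ := Nat.squarefree_mul_iff.1 hsq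
  have hceu := (Nat.squarefree_mul_iff.1 hsq').1
  obtain ⟨⟨⟨he0, hu0⟩, hv0⟩, hw0⟩ : ((e ≠ 0 ∧ u ≠ 0) ∧ v ≠ 0) ∧ w ≠ 0 := by
    simpa only [mul_ne_zero_iff] using hsq.ne_zero
  obtain ⟨α, β, γ, hα, hβ, hγ⟩ := hsplit.exists_dvd_of_squarefree hD hq hsq h3
  obtain ⟨X, Y, Z, hXYZ⟩ := exists_mul_sq_add_eq_mul_mul (u := u) (v := v) (w := w) (e := e)
    (by positivity) (by positivity) (by positivity) (by positivity) (by exact_mod_cast he)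
    (Nat.isCoprime_iff_coprime.2 hceu.coprime_mul_left)
    (Nat.isCoprime_iff_coprime.2 hceuv.coprime_mul_right.coprime_mul_left)
    (Nat.isCoprime_iff_coprime.2 hceuv.coprime_mul_left) hα hβ hγ
  have hXYZ' : (w * X ^ 2 + e * u * Y ^ 2 + v * Z ^ 2 : ℚ) = u * v * w := by exact_mod_cast hXYZ
  obtain ⟨i, hi⟩ := hq.exists_mul_self_eq (X / (u * v)) (e * Y / (v * w)) (Z / (u * v * w))
  refine ⟨i, hi.trans (congrArg _ ?_)⟩
  push_cast
  field_simp
  linear_combination -hXYZ'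

variable [IsDomain D] [Algebra.IsCentral ℚ D]

theorem IsSplitAwayFromTwoThree.exists_squarefree_of_mul_self_eq_neg
    (hsplit : IsSplitAwayFromTwoThree D) (hinf : IsDivisionOver ℝ D)
    (hD : Module.finrank ℚ D = 4) {e : ℕ} (he : e ≠ 0) {i : D}
    (hi : i * i = algebraMap ℚ D (-e)) :
    ∃ n : ℕ, Squarefree n ∧ HasQuaternionBasis D (-e : ℚ) (-n) ∧
      ∀ p : ℕ, p.Prime → p ∣ n → p ≠ 3 → IsSquare (-(e : ZMod p)) := by
  have he' : (0 : ℚ) < e := by positivity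
  have hi' : ∀ r, i ≠ algebraMap ℚ D r := by
    rintro r rfl
    rw [← map_mul, (algebraMap ℚ D).injective.eq_iff] at hi
    nlinarith [mul_self_nonneg r]
  obtain ⟨b, hb, hq⟩ := exists_hasQuaternionBasis_of_mul_self hD hi hi'
  obtain ⟨n, hn, hq'⟩ := hq.exists_squarefree
    (neg_of_isDivisionOver_real hD hq (neg_ne_zero.2 he'.ne') hb hinf).2
  exact ⟨n, hn, hq', fun p hp hpn ↦ hsplit.isSquare_neg hD hq'.swap hn he hp hpn⟩

theorem exists_eq_mul_of_squarefree {n p : ℕ} (hn : Squarefree n) (hp : p.Prime) :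
    ∃ k m, n = k * m ∧ (k = 1 ∨ k = p) ∧ Squarefree m ∧ ¬p ∣ m := by
  by_cases h : p ∣ n
  · obtain ⟨m, rfl⟩ := h
    obtain ⟨hcop, -, hm⟩ := Nat.squarefree_mul_iff.1 hn
    exact ⟨p, m, rfl, .inr rfl, hm, hp.coprime_iff_not_dvd.1 hcop⟩
  · exact ⟨1, n, (one_mul n).symm, .inl rfl, hn, h⟩

theorem IsSplitAwayFromTwoThree.hasQuaternionBasis_of_mul_self_eq_neg_one
    (hsplit : IsSplitAwayFromTwoThree D) (hinf : IsDivisionOver ℝ D)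
    (hD : Module.finrank ℚ D = 4) {i : D} (hi : i * i = algebraMap ℚ D (-(1 : ℕ))) :
    HasQuaternionBasis D (-1 : ℚ) (-1) ∨ HasQuaternionBasis D (-1 : ℚ) (-3) := by
  obtain ⟨n, hn, hq, hsquare⟩ :=
    hsplit.exists_squarefree_of_mul_self_eq_neg hinf hD one_ne_zero hi
  obtain ⟨k, m, rfl, hk, hm, hm3⟩ := exists_eq_mul_of_squarefree hn Nat.prime_three
  have hsquare_m : IsSquare ((-1 : ℤ) : ZMod m) :=
    isSquare_intCast_zmod_of_squarefree hm fun p hp hpm ↦ by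
      simpa using hsquare p hp (hpm.mul_left k) (by rintro rfl; exact hm3 hpm)
  obtain ⟨x, y, hxy⟩ := Nat.eq_sq_add_sq_of_isSquare_mod_neg_one (n := m) (by simpa using hsquare_m)
  have hnorm : (m : ℚ) = x ^ 2 - -1 * y ^ 2 := by
    rw [hxy]; push_cast; ring
  have hq' : HasQuaternionBasis D (-1 : ℚ) (-k * m) := by simpa using hq
  have hqk := hq'.of_mul_norm (Nat.cast_ne_zero.2 hm.ne_zero) hnorm
  rcases hk with rfl | rfl
  · exact .inl (by simpa using hqk)
  · exact .inr (by simpa using hqk)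

theorem IsSplitAwayFromTwoThree.hasQuaternionBasis_of_mul_self_eq_neg_three
    (hsplit : IsSplitAwayFromTwoThree D) (hinf : IsDivisionOver ℝ D)
    (hD : Module.finrank ℚ D = 4) {i : D} (hi : i * i = algebraMap ℚ D (-(3 : ℕ))) :
    HasQuaternionBasis D (-1 : ℚ) (-1) ∨ HasQuaternionBasis D (-1 : ℚ) (-3) := by
  obtain ⟨n, hn, hq, hsquare⟩ :=
    hsplit.exists_squarefree_of_mul_self_eq_neg hinf hD three_ne_zero hi
  obtain ⟨k, m, rfl, hk, hm, hm3⟩ := exists_eq_mul_of_squarefree hn Nat.prime_three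
  obtain ⟨l, t, rfl, hl, ht, ht2⟩ := exists_eq_mul_of_squarefree hm Nat.prime_two
  obtain ⟨r, hr⟩ : IsSquare ((-3 : ℤ) : ZMod t) :=
    isSquare_intCast_zmod_of_squarefree ht fun p hp hpt ↦ by
      simpa using hsquare p hp ((hpt.mul_left l).mul_left k)
        (by rintro rfl; exact hm3 (hpt.mul_left l))
  obtain ⟨s, rfl⟩ := ZMod.intCast_surjective r
  obtain ⟨x, y, hxy⟩ := exists_eq_sq_add_three_mul_sq (n := t) (s := s)
    (by rwa [← Nat.not_even_iff_odd, even_iff_two_dvd])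
    ((ZMod.intCast_zmod_eq_zero_iff_dvd _ _).1 (by push_cast at hr ⊢; linear_combination -hr))
  have hnorm : (t : ℚ) = x ^ 2 - -3 * y ^ 2 := by
    rw [neg_mul, sub_neg_eq_add]; exact_mod_cast hxy
  have hqt : HasQuaternionBasis D (-3 : ℚ) (-l * k * t) := by
    rw [show (-l * k * t : ℚ) = -(k * (l * t) : ℕ) by push_cast; ring]
    exact_mod_cast hq
  have hqkl := hqt.of_mul_norm (Nat.cast_ne_zero.2 ht.ne_zero) hnorm
  have hql : HasQuaternionBasis D (-3 : ℚ) (-l) := by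
    rcases hk with rfl | rfl
    · simpa using hqkl
    · exact hqkl.of_mul_norm (x := 0) (y := 1) (by norm_num) (by norm_num)
  rcases hl with rfl | rfl
  · exact .inr (by simpa using hql.swap)
  · exact .inl (by exact_mod_cast hql.neg_one_neg_one_of_neg_three_neg_two)

theorem exists_squarefree_hasQuaternionBasis (hinf : IsDivisionOver ℝ D)
    (hD : Module.finrank ℚ D = 4) :
    ∃ u v w : ℕ, Squarefree (u * v * w) ∧
      HasQuaternionBasis D (-(u * v : ℕ) : ℚ) (-(v * w : ℕ)) := by
  obtain ⟨a, b, ha, hb, hq⟩ := exists_hasQuaternionBasis (F := ℚ) (D := D) hD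
  obtain ⟨ha', hb'⟩ := neg_of_isDivisionOver_real hD hq ha hb hinf
  obtain ⟨B, hB, hqB⟩ := hq.exists_squarefree hb'
  obtain ⟨A, hA, hqA⟩ := hqB.swap.exists_squarefree ha'
  obtain ⟨v, u, w, -, huw, rfl, rfl⟩ := Nat.exists_coprime' (m := A) (n := B)
    (Nat.gcd_pos_of_pos_left _ (Nat.pos_of_ne_zero hA.ne_zero))
  obtain ⟨hwv, hw, -⟩ := Nat.squarefree_mul_iff.1 hB
  exact ⟨u, v, w, Nat.squarefree_mul_iff.2 ⟨.mul_left huw hwv.symm, hA, hw⟩,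
    mul_comm w v ▸ hqA.swap⟩

theorem IsSplitAwayFromTwoThree.hasQuaternionBasis_of_three_dvd
    (hsplit : IsSplitAwayFromTwoThree D) (hinf : IsDivisionOver ℝ D)
    (hD : Module.finrank ℚ D = 4) {u v w : ℕ}
    (hq : HasQuaternionBasis D (-(u * v : ℕ) : ℚ) (-(v * w : ℕ))) (hsq : Squarefree (u * v * w))
    (hu : 3 ∣ u) : HasQuaternionBasis D (-1 : ℚ) (-1) ∨ HasQuaternionBasis D (-1 : ℚ) (-3) := by
  obtain ⟨u, rfl⟩ := hu
  have hsq' : Squarefree (3 * (u * v * w)) := by convert hsq using 1; ring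
  have h3 : ¬3 ∣ u * v * w :=
    Nat.prime_three.coprime_iff_not_dvd.1 (Nat.squarefree_mul_iff.1 hsq').1
  obtain ⟨i, hi⟩ := hsplit.exists_mul_self_eq_neg hD hq hsq le_rfl h3
  exact hsplit.hasQuaternionBasis_of_mul_self_eq_neg_three hinf hD hi

theorem IsSplitAwayFromTwoThree.hasQuaternionBasis (hsplit : IsSplitAwayFromTwoThree D)
    (hinf : IsDivisionOver ℝ D) (hD : Module.finrank ℚ D = 4) :
    HasQuaternionBasis D (-1 : ℚ) (-1) ∨ HasQuaternionBasis D (-1 : ℚ) (-3) := by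
  obtain ⟨u, v, w, hsq, hq⟩ := exists_squarefree_hasQuaternionBasis hinf hD
  by_cases h3 : 3 ∣ u * v * w
  · obtain (h3u | h3v) | h3w : (3 ∣ u ∨ 3 ∣ v) ∨ 3 ∣ w := by
      simpa only [Nat.prime_three.dvd_mul] using h3
    · exact hsplit.hasQuaternionBasis_of_three_dvd hinf hD hq hsq h3u
    · have hv : (v : ℚ) ≠ 0 := by
        exact_mod_cast right_ne_zero_of_mul (left_ne_zero_of_mul hsq.ne_zero)
      refine hsplit.hasQuaternionBasis_of_three_dvd hinf hD (u := v) (v := u) (w := w) ?_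
        (mul_comm u v ▸ hsq) h3v
      rw [mul_comm v u]
      convert hq.mul_norm 0 (1 / v) using 1
      push_cast; field_simp; ring
    · refine hsplit.hasQuaternionBasis_of_three_dvd hinf hD (u := w) (v := v) (w := u) ?_
        (by convert hsq using 1; ring) h3w
      rw [mul_comm w v, mul_comm v u]
      exact hq.swap
  · obtain ⟨i, hi⟩ := hsplit.exists_mul_self_eq_neg hD (e := 1) (by simpa using hq)
      (by simpa using hsq) (by norm_num) h3
    exact hsplit.hasQuaternionBasis_of_mul_self_eq_neg_one hinf hD hi

end Definite

end LocalGlobal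

section Ramification

variable {D : Type*} [Ring D] [Algebra ℚ D]

theorem ramificationSet_eq_of_forall {P : ℕ} (hP : P.Prime) (hinf : IsDivisionOver ℝ D)
    (h : ∀ (p : ℕ) [Fact p.Prime], IsDivisionOver ℚ_[p] D ↔ p = P) :
    ramificationSet D = {.finite P hP, .infinite} := by
  ext v
  cases v with
  | finite p hp =>
    have : Fact p.Prime := ⟨hp⟩
    simpa [ramificationSet, IsRamifiedAt] using h p
  | infinite => simpa [ramificationSet, IsRamifiedAt] using hinf

theorem isDivisionOver_real_of_neg (hD : Module.finrank ℚ D = 4) {a b : ℚ}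
    (h : HasQuaternionBasis D a b) (ha : a < 0) (hb : b < 0) : IsDivisionOver ℝ D := by
  rw [isDivisionOver_iff hD h ha.ne hb.ne, isNormFormAnisotropic_real_iff]
  exact ⟨by simpa using ha, by simpa using hb⟩

theorem HasQuaternionBasis.ramificationSet_eq_two (hD : Module.finrank ℚ D = 4)
    (h : HasQuaternionBasis D (-1 : ℚ) (-1)) : ramificationSet D = {placeTwo, .infinite} := by
  refine ramificationSet_eq_of_forall Nat.prime_two
    (isDivisionOver_real_of_neg hD h (by norm_num) (by norm_num)) fun p hp ↦ ?_
  rw [isDivisionOver_iff hD h (by norm_num) (by norm_num), map_neg, map_one]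
  constructor
  · contrapose!
    intro hp2
    simpa using not_isNormFormAnisotropic_neg_one_padic (c := 1) hp2
      (by exact_mod_cast hp.out.not_dvd_one)
  · rintro rfl
    exact isNormFormAnisotropic_neg_one_neg_one_padic_two

theorem not_isSquare_neg_one_zmod_three : ¬IsSquare (-((1 : ℤ) : ZMod 3)) := by
  decide

theorem HasQuaternionBasis.ramificationSet_eq_three (hD : Module.finrank ℚ D = 4)
    (h : HasQuaternionBasis D (-1 : ℚ) (-3)) : ramificationSet D = {placeThree, .infinite} := by
  refine ramificationSet_eq_of_forall Nat.prime_three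
    (isDivisionOver_real_of_neg hD h (by norm_num) (by norm_num)) fun p hp ↦ ⟨?_, ?_⟩
  · rw [isDivisionOver_iff hD h (by norm_num) (by norm_num), map_neg, map_one, map_neg,
      map_ofNat]
    contrapose!
    intro hp3
    rcases eq_or_ne p 2 with rfl | hp2
    · exact not_isNormFormAnisotropic_neg_one_neg_three_padic_two
    · have hdvd : ¬p ∣ 3 := by rwa [Nat.prime_dvd_prime_iff_eq hp.out Nat.prime_three]
      simpa using not_isNormFormAnisotropic_neg_one_padic (c := 3) hp2 (by exact_mod_cast hdvd)
  · rintro rfl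
    rw [isDivisionOver_iff hD h.swap (by norm_num) (by norm_num)]
    simpa using isNormFormAnisotropic_padic_of_not_isSquare (p := 3) (c := 1) (m := 3)
      not_isSquare_neg_one_zmod_three (by norm_num) (by norm_num)

theorem pair_placeTwo_infinite_ne_pair_placeThree_infinite :
    ({placeTwo, .infinite} : Set RatPlace) ≠ {placeThree, .infinite} := by
  intro h
  have hmem : placeTwo ∈ ({placeThree, .infinite} : Set RatPlace) := h ▸ Set.mem_insert _ _
  simp [placeTwo, placeThree] at hmem

variable [IsDomain D] [Algebra.IsCentral ℚ D]

theorem hasQuaternionBasis_of_ramificationSet_eq (hD : Module.finrank ℚ D = 4) {P : ℕ}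
    (hP : P.Prime) (hP' : P = 2 ∨ P = 3) (h : ramificationSet D = {.finite P hP, .infinite}) :
    HasQuaternionBasis D (-1 : ℚ) (-1) ∨ HasQuaternionBasis D (-1 : ℚ) (-3) := by
  have hinf : RatPlace.infinite ∈ ramificationSet D := by simp [h]
  have hsplit : IsSplitAwayFromTwoThree D := by
    intro p hp hp2 hp3 hdiv
    have hmem : RatPlace.finite p hp.out ∈ ramificationSet D := hdiv
    obtain rfl : p = P := by simpa [h] using hmem
    exact hP'.elim hp2 hp3
  exact hsplit.hasQuaternionBasis hinf hD

theorem ramificationSet_eq_two_iff (hD : Module.finrank ℚ D = 4) :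
    ramificationSet D = {placeTwo, .infinite} ↔ HasQuaternionBasis D (-1 : ℚ) (-1) := by
  refine ⟨fun h ↦ ?_, fun h ↦ h.ramificationSet_eq_two hD⟩
  refine (hasQuaternionBasis_of_ramificationSet_eq hD Nat.prime_two (.inl rfl) h).resolve_right
    fun h' ↦ pair_placeTwo_infinite_ne_pair_placeThree_infinite ?_
  rw [← h, h'.ramificationSet_eq_three hD]

theorem ramificationSet_eq_three_iff (hD : Module.finrank ℚ D = 4) :
    ramificationSet D = {placeThree, .infinite} ↔ HasQuaternionBasis D (-1 : ℚ) (-3) := by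
  refine ⟨fun h ↦ ?_, fun h ↦ h.ramificationSet_eq_three hD⟩
  refine (hasQuaternionBasis_of_ramificationSet_eq hD Nat.prime_three (.inr rfl) h).resolve_left
    fun h' ↦ pair_placeTwo_infinite_ne_pair_placeThree_infinite ?_
  rw [← h, h'.ramificationSet_eq_two hD]

end Ramification

section FiniteOrder

open Polynomial

theorem dvd_twelve_of_totient_le_two {n : ℕ} (hn : 0 < n) (h : n.totient ≤ 2) : n ∣ 12 := by
  have htotient {m : ℕ} (hm : m ∣ n) : m.totient ≤ 2 :=
    (Nat.le_of_dvd (Nat.totient_pos.2 hn) (Nat.totient_dvd_of_dvd hm)).trans h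
  have h8 : ¬8 ∣ n := fun h8 ↦ absurd (htotient h8) (by decide)
  have h9 : ¬9 ∣ n := fun h9 ↦ absurd (htotient h9) (by decide)
  rw [Nat.dvd_iff_prime_pow_dvd_dvd]
  intro p k hp hpk
  rcases Nat.eq_zero_or_pos k with rfl | hk
  · simp
  have hp3 : p ≤ 3 := by
    have := htotient ((dvd_pow_self p hk.ne').trans hpk)
    rw [Nat.totient_prime hp] at this
    omega
  obtain rfl | rfl : p = 2 ∨ p = 3 := by have := hp.two_le; omega
  · have hk3 : k ≤ 2 := Nat.lt_succ_iff.1 <| not_le.1 fun hk3 ↦ h8 ((pow_dvd_pow 2 hk3).trans hpk)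
    exact (pow_dvd_pow 2 hk3).trans (by norm_num)
  · have hk2 : k ≤ 1 := Nat.lt_succ_iff.1 <| not_le.1 fun hk2 ↦ h9 ((pow_dvd_pow 3 hk2).trans hpk)
    exact (pow_dvd_pow 3 hk2).trans (by norm_num)

theorem eq_of_totient_le_two {n : ℕ} (hn : 0 < n) (h : n.totient ≤ 2) :
    n = 1 ∨ n = 2 ∨ n = 3 ∨ n = 4 ∨ n = 6 := by
  have hdvd := dvd_twelve_of_totient_le_two hn h
  have h12 : n ≠ 12 := by
    rintro rfl
    exact absurd h (by decide)
  have hle : n ≤ 12 := Nat.le_of_dvd (by norm_num) hdvd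
  interval_cases n <;> omega

variable {D : Type*} [Ring D] [IsDomain D] [Algebra ℚ D] {g : D}

theorem minpoly_rat_eq_cyclotomic_orderOf (hg : IsOfFinOrder g) :
    minpoly ℚ g = cyclotomic (orderOf g) ℚ := by
  have hn : 0 < orderOf g := hg.orderOf_pos
  have hroot : aeval g (X ^ orderOf g - 1 : ℚ[X]) = 0 := by simp [pow_orderOf_eq_one]
  have hint : IsIntegral ℚ g := ⟨_, monic_X_pow_sub_C 1 hn.ne', by simp⟩
  have hirr : Irreducible (minpoly ℚ g) := minpoly.irreducible hint
  have hdvd : minpoly ℚ g ∣ ∏ d ∈ (orderOf g).divisors, cyclotomic d ℚ := by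
    rw [prod_cyclotomic_eq_X_pow_sub_one hn]
    exact minpoly.dvd ℚ g hroot
  obtain ⟨d, hd, hdvd⟩ := (hirr.prime.dvd_finsetProd_iff _).1 hdvd
  have hmin : minpoly ℚ g = cyclotomic d ℚ :=
    eq_of_monic_of_associated (minpoly.monic hint) (cyclotomic.monic d ℚ)
      (hirr.associated_of_dvd (cyclotomic.irreducible_rat (Nat.pos_of_mem_divisors hd)) hdvd)
  have hgd : g ^ d = 1 := by
    have hroot : aeval g (X ^ d - 1 : ℚ[X]) = 0 :=
      minpoly.dvd_iff.1 (hmin ▸ cyclotomic.dvd_X_pow_sub_one d ℚ)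
    simpa [sub_eq_zero] using hroot
  rw [hmin, Nat.dvd_antisymm (orderOf_dvd_of_pow_eq_one hgd) (Nat.dvd_of_mem_divisors hd)]

theorem exists_int_mul_self_add_one_eq_mul (hg : IsOfFinOrder g)
    (hdeg : (minpoly ℚ g).natDegree ≤ 2) : ∃ t : ℤ, -2 ≤ t ∧ t ≤ 2 ∧ g * g + 1 = t * g := by
  have hmin := minpoly_rat_eq_cyclotomic_orderOf hg
  have hroot : aeval g (cyclotomic (orderOf g) ℚ) = 0 := hmin ▸ minpoly.aeval ℚ g
  have htotient : (orderOf g).totient ≤ 2 := by rwa [hmin, natDegree_cyclotomic] at hdeg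
  rcases eq_of_totient_le_two hg.orderOf_pos htotient with h | h | h | h | h
  · rw [h, cyclotomic_one, map_sub, aeval_X, map_one, sub_eq_zero] at hroot
    exact ⟨2, by norm_num, by norm_num, by rw [hroot]; norm_num⟩
  · rw [h, cyclotomic_two, map_add, aeval_X, map_one] at hroot
    exact ⟨-2, by norm_num, by norm_num, by rw [eq_neg_of_add_eq_zero_left hroot]; norm_num⟩
  · rw [h, cyclotomic_three] at hroot
    refine ⟨-1, by norm_num, by norm_num, sub_eq_zero.1 (.trans ?_ hroot)⟩
    simp only [map_add, map_mul, map_one, aeval_X, Int.cast_neg, Int.cast_one, neg_mul, one_mul, sq]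
    abel
  · rw [h, show 4 = 2 ^ (1 + 1) from rfl, cyclotomic_prime_pow_eq_geom_sum Nat.prime_two] at hroot
    refine ⟨0, by norm_num, by norm_num, sub_eq_zero.1 (.trans ?_ hroot)⟩
    simp [Finset.sum_range_succ, sq, add_comm]
  · rw [h, cyclotomic_six] at hroot
    refine ⟨1, by norm_num, by norm_num, sub_eq_zero.1 (.trans ?_ hroot)⟩
    simp only [map_add, map_sub, map_mul, map_one, aeval_X, Int.cast_one, one_mul, sq]
    abel

end FiniteOrder

section QuaternionGroupLift

variable {G : Type*} [Group G] {n : ℕ} {ζ x : G}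

theorem exists_zmod_multiplicative_hom_eq_zpow {m : ℕ} (hζ : ζ ^ m = 1) :
    ∃ z : Multiplicative (ZMod m) →* G, ∀ k : ℤ, z (.ofAdd (k : ZMod m)) = ζ ^ k := by
  let f : ZMod m →+ Additive G := ZMod.lift m ⟨zmultiplesHom (Additive G) (.ofMul ζ), by
    rw [zmultiplesHom_apply, ← ofMul_zpow]
    exact_mod_cast congrArg Additive.ofMul hζ⟩
  exact ⟨f.toMultiplicativeLeft, fun k ↦ by simp [f]⟩

theorem exists_quaternionGroup_hom (hζ : ζ ^ (2 * n) = 1) (hx : x ^ 2 = ζ ^ n)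
    (hζx : ζ * x = x * ζ⁻¹) :
    ∃ φ : QuaternionGroup n →* G, ∀ k : ℤ, φ (.a k) = ζ ^ k ∧ φ (.xa k) = x * ζ ^ k := by
  obtain ⟨f, hf⟩ := exists_zmod_multiplicative_hom_eq_zpow hζ
  let z (i : ZMod (2 * n)) : G := f (.ofAdd i)
  have hz_add (i j) : z (i + j) = z i * z j := by simp [z]
  have hz_mul (i) : z i * x = x * z (-i) := by
    obtain ⟨k, rfl⟩ := ZMod.intCast_surjective i
    rw [← Int.cast_neg]
    simpa [z, hf, inv_zpow'] using ((show SemiconjBy x ζ⁻¹ ζ from hζx.symm).zpow_right k).eq.symm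
  have hx_mul : x * x = z n := by
    rw [← sq, hx, ← zpow_natCast, ← hf, Int.cast_natCast]
  refine ⟨MonoidHom.mk' (fun g ↦ match g with | .a i => z i | .xa i => x * z i) ?_, fun k ↦
    ⟨hf k, congrArg (x * ·) (hf k)⟩⟩
  rintro (i | i) (j | j)
  · simp only [QuaternionGroup.a_mul_a, hz_add]
  · simp only [QuaternionGroup.a_mul_xa]
    rw [← mul_assoc, hz_mul, mul_assoc, ← hz_add, neg_add_eq_sub]
  · simp only [QuaternionGroup.xa_mul_a, hz_add, mul_assoc]
  · simp only [QuaternionGroup.xa_mul_xa]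
    rw [mul_assoc, ← mul_assoc (z i), hz_mul, mul_assoc x (z (-i)), ← mul_assoc x x, hx_mul,
      ← hz_add, ← hz_add, neg_add_eq_sub, add_sub_assoc]

theorem exists_injective_quaternionGroup_hom (hζ : orderOf ζ = 2 * n) (hx : x ^ 2 = ζ ^ n)
    (hζx : ζ * x = x * ζ⁻¹) (hne : ζ * x ≠ x * ζ) :
    ∃ φ : QuaternionGroup n →* G, Function.Injective φ ∧
      ∀ k : ℤ, φ (.a k) = ζ ^ k ∧ φ (.xa k) = x * ζ ^ k := by
  obtain ⟨φ, hφ⟩ := exists_quaternionGroup_hom (hζ ▸ pow_orderOf_eq_one ζ) hx hζx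
  refine ⟨φ, (injective_iff_map_eq_one φ).2 ?_, hφ⟩
  rintro (i | i) h
  · obtain ⟨k, rfl⟩ := ZMod.intCast_surjective i
    rw [(hφ k).1, ← orderOf_dvd_iff_zpow_eq_one, hζ] at h
    rw [QuaternionGroup.one_def, (ZMod.intCast_zmod_eq_zero_iff_dvd k (2 * n)).2 h]
  · obtain ⟨k, rfl⟩ := ZMod.intCast_surjective i
    rw [(hφ k).2, mul_eq_one_iff_eq_inv] at h
    exact absurd (h ▸ ((Commute.refl ζ).zpow_right k).inv_right.eq) hne

end QuaternionGroupLift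

section BinaryTetrahedral

theorem four_dvd_two_mul_sub_of_sum_four_sq_eq_four {a b c d : ℤ}
    (h : a ^ 2 + b ^ 2 + c ^ 2 + d ^ 2 = 4) :
    4 ∣ 2 * (a - d) ∧ 4 ∣ 2 * (b - d) ∧ 4 ∣ 2 * (c - d) := by
  have hmod : ∀ a b c d : ZMod 4, a ^ 2 + b ^ 2 + c ^ 2 + d ^ 2 = 4 →
      2 * (a - d) = 0 ∧ 2 * (b - d) = 0 ∧ 2 * (c - d) = 0 := by decide
  have hdvd (x : ℤ) : 4 ∣ x ↔ (x : ZMod 4) = 0 := by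
    exact_mod_cast (ZMod.intCast_zmod_eq_zero_iff_dvd x 4).symm
  simp only [hdvd]
  push_cast
  exact hmod a b c d (mod_cast congrArg (Int.cast : ℤ → ZMod 4) h)

theorem exists_eq_two_mul_add_of_sum_four_sq_eq_four {a b c d : ℤ}
    (h : a ^ 2 + b ^ 2 + c ^ 2 + d ^ 2 = 4) :
    ∃ a' b' c', a = 2 * a' + d ∧ b = 2 * b' + d ∧ c = 2 * c' + d := by
  obtain ⟨ha, hb, hc⟩ := four_dvd_two_mul_sub_of_sum_four_sq_eq_four h
  exact ⟨(a - d) / 2, (b - d) / 2, (c - d) / 2, by omega, by omega, by omega⟩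

/-- The quaternion `(a + b i + c j + d k) / 2` with doubled coordinates `(a, b, c, d)`. In doubled
coordinates the Hurwitz units are integral, so that they can be enumerated. -/
def halfQuaternion (v : ℤ × ℤ × ℤ × ℤ) : ℍ[ℚ] :=
  ⟨v.1 / 2, v.2.1 / 2, v.2.2.1 / 2, v.2.2.2 / 2⟩

theorem halfQuaternion_injective : Function.Injective halfQuaternion := by
  rintro ⟨a, b, c, d⟩ ⟨a', b', c', d'⟩ h
  simpa [halfQuaternion] using QuaternionAlgebra.ext_iff.1 h

theorem normSq_halfQuaternion (v : ℤ × ℤ × ℤ × ℤ) : Quaternion.normSq (halfQuaternion v) =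
    ((v.1 ^ 2 + v.2.1 ^ 2 + v.2.2.1 ^ 2 + v.2.2.2 ^ 2 : ℤ) : ℚ) / 4 := by
  rw [Quaternion.normSq_def', halfQuaternion]
  push_cast
  ring

theorem normSq_halfQuaternion_eq_one_iff {v : ℤ × ℤ × ℤ × ℤ} :
    Quaternion.normSq (halfQuaternion v) = 1 ↔
      v.1 ^ 2 + v.2.1 ^ 2 + v.2.2.1 ^ 2 + v.2.2.2 ^ 2 = 4 := by
  rw [normSq_halfQuaternion, div_eq_one_iff_eq (by norm_num)]
  norm_cast

theorem isHurwitz_halfQuaternion {v : ℤ × ℤ × ℤ × ℤ}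
    (hv : Quaternion.normSq (halfQuaternion v) = 1) : IsHurwitz (halfQuaternion v) := by
  obtain ⟨a, b, c, d⟩ := v
  have hsum : a ^ 2 + b ^ 2 + c ^ 2 + d ^ 2 = 4 := normSq_halfQuaternion_eq_one_iff.1 hv
  obtain ⟨a, b, c, rfl, rfl, rfl⟩ := exists_eq_two_mul_add_of_sum_four_sq_eq_four hsum
  refine ⟨a, b, c, d, ?_, ?_, ?_, rfl⟩ <;> simp only [halfQuaternion] <;> push_cast <;> ring

theorem IsHurwitz.exists_eq_halfQuaternion {x : ℍ[ℚ]} (hx : IsHurwitz x) :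
    ∃ v, halfQuaternion v = x := by
  obtain ⟨a, b, c, d, hre, himI, himJ, himK⟩ := hx
  refine ⟨(2 * a + d, 2 * b + d, 2 * c + d, d), ?_⟩
  ext <;> simp only [halfQuaternion, hre, himI, himJ, himK] <;> push_cast <;> ring

/-- The doubled coordinates of the Hurwitz units. -/
noncomputable def hurwitzUnitCoords : Finset (ℤ × ℤ × ℤ × ℤ) :=
  (Finset.Icc (-2) 2 ×ˢ Finset.Icc (-2) 2 ×ˢ Finset.Icc (-2) 2 ×ˢ Finset.Icc (-2) 2).filter
    fun v ↦ v.1 ^ 2 + v.2.1 ^ 2 + v.2.2.1 ^ 2 + v.2.2.2 ^ 2 = 4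

theorem card_hurwitzUnitCoords : hurwitzUnitCoords.card = 24 := by
  decide +kernel

theorem mem_hurwitzUnitCoords {v : ℤ × ℤ × ℤ × ℤ} :
    v ∈ hurwitzUnitCoords ↔ v.1 ^ 2 + v.2.1 ^ 2 + v.2.2.1 ^ 2 + v.2.2.2 ^ 2 = 4 := by
  have hbound (z : ℤ) (hz : z ^ 2 ≤ 4) : -2 ≤ z ∧ z ≤ 2 :=
    abs_le.1 (abs_le_of_sq_le_sq (by linarith) (by norm_num))
  simp only [hurwitzUnitCoords, Finset.mem_filter, Finset.mem_product, Finset.mem_Icc,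
    and_iff_right_iff_imp]
  intro h
  refine ⟨hbound _ ?_, hbound _ ?_, hbound _ ?_, hbound _ ?_⟩ <;>
    linarith [sq_nonneg v.1, sq_nonneg v.2.1, sq_nonneg v.2.2.1, sq_nonneg v.2.2.2]

theorem setOf_isHurwitz_and_normSq_eq_one :
    {x : ℍ[ℚ] | IsHurwitz x ∧ Quaternion.normSq x = 1} = halfQuaternion '' hurwitzUnitCoords := by
  ext x
  constructor
  · rintro ⟨hx, hnorm⟩
    obtain ⟨v, rfl⟩ := hx.exists_eq_halfQuaternion
    exact ⟨v, mem_hurwitzUnitCoords.2 (normSq_halfQuaternion_eq_one_iff.1 hnorm), rfl⟩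
  · rintro ⟨v, hv, rfl⟩
    have hnorm := normSq_halfQuaternion_eq_one_iff.2 (mem_hurwitzUnitCoords.1 hv)
    exact ⟨isHurwitz_halfQuaternion hnorm, hnorm⟩

theorem binaryTetrahedralGroup_ext {u v : binaryTetrahedralGroup}
    (h : ((u : ℍ[ℚ]ˣ) : ℍ[ℚ]) = (v : ℍ[ℚ]ˣ)) : u = v :=
  Subtype.ext (Units.ext h)

theorem exists_mem_binaryTetrahedralGroup {x : ℍ[ℚ]} (hx : IsHurwitz x)
    (hnorm : Quaternion.normSq x = 1) :
    ∃ u : binaryTetrahedralGroup, ((u : ℍ[ℚ]ˣ) : ℍ[ℚ]) = x := by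
  have hx0 : x ≠ 0 := Quaternion.normSq_ne_zero.1 (by simp [hnorm])
  exact ⟨⟨Units.mk0 x hx0, hx, hnorm⟩, rfl⟩

theorem card_binaryTetrahedralGroup : Nat.card binaryTetrahedralGroup = 24 := by
  let f : binaryTetrahedralGroup → {x : ℍ[ℚ] | IsHurwitz x ∧ Quaternion.normSq x = 1} :=
    fun u ↦ ⟨u.1.1, u.2⟩
  have hf : Function.Bijective f := by
    refine ⟨fun u v h ↦ binaryTetrahedralGroup_ext (congrArg Subtype.val h), fun ⟨x, hx⟩ ↦ ?_⟩
    obtain ⟨u, hu⟩ := exists_mem_binaryTetrahedralGroup hx.1 hx.2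
    exact ⟨u, Subtype.ext hu⟩
  rw [Nat.card_congr (Equiv.ofBijective f hf), Nat.card_coe_set_eq,
    setOf_isHurwitz_and_normSq_eq_one, Set.ncard_image_of_injective _ halfQuaternion_injective,
    Set.ncard_coe_finset, card_hurwitzUnitCoords]

instance : Finite binaryTetrahedralGroup :=
  Nat.finite_of_card_ne_zero (by rw [card_binaryTetrahedralGroup]; norm_num)

theorem normSq_eq_one_of_isOfFinOrder {x : ℍ[ℚ]} (hx : IsOfFinOrder x) :
    Quaternion.normSq x = 1 := by
  obtain ⟨n, hn, hxn⟩ := hx.exists_pow_eq_one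
  refine (pow_eq_one_iff_of_nonneg Quaternion.normSq_nonneg hn.ne').1 ?_
  rw [← map_pow, hxn, map_one]

theorem quaternion_mul_self_add_normSq (x : ℍ[ℚ]) :
    x * x + algebraMap ℚ ℍ[ℚ] (Quaternion.normSq x) = (2 * x.re) • x := by
  rw [Quaternion.normSq_def']
  ext <;> simp <;> ring

open Polynomial in
theorem natDegree_minpoly_quaternion_le_two (x : ℍ[ℚ]) : (minpoly ℚ x).natDegree ≤ 2 := by
  let P : ℚ[X] := X ^ 2 - (C (2 * x.re) * X - C (Quaternion.normSq x))
  have hmonic : P.Monic := monic_X_pow_sub (by compute_degree!)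
  have hroot : aeval x P = 0 := by
    simp only [P, map_sub, map_mul, map_pow, aeval_X, aeval_C]
    rw [← sub_add, sq, sub_add_eq_add_sub, quaternion_mul_self_add_normSq, sub_eq_zero,
      Algebra.smul_def, map_mul]
  have hdeg : P.natDegree ≤ 2 := by simp only [P]; compute_degree
  exact (natDegree_le_of_dvd (minpoly.dvd ℚ x hroot) hmonic.ne_zero).trans hdeg

theorem exists_two_mul_re_eq_intCast {x : ℍ[ℚ]} (hx : IsOfFinOrder x) :
    ∃ t : ℤ, 2 * x.re = t := by
  obtain ⟨t, -, -, ht⟩ :=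
    exists_int_mul_self_add_one_eq_mul hx (natDegree_minpoly_quaternion_le_two x)
  have hnorm := normSq_eq_one_of_isOfFinOrder hx
  have hx0 : x ≠ 0 := Quaternion.normSq_ne_zero.1 (by simp [hnorm])
  have hre := quaternion_mul_self_add_normSq x
  rw [hnorm, map_one, ht, Algebra.smul_def] at hre
  refine ⟨t, (algebraMap ℚ ℍ[ℚ]).injective ?_⟩
  rw [map_intCast]
  exact (mul_right_cancel₀ hx0 hre).symm

/-- The traces of `u`, `u i`, `u j` and `u i j` are the doubled coordinates of `u` up to sign. -/
theorem le_binaryTetrahedralGroup {H : Subgroup ℍ[ℚ]ˣ} [Finite H] {i j : ℍ[ℚ]ˣ} (hi : i ∈ H)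
    (hj : j ∈ H) (hi' : (i : ℍ[ℚ]) = ⟨0, 1, 0, 0⟩) (hj' : (j : ℍ[ℚ]) = ⟨0, 0, 1, 0⟩) :
    H ≤ binaryTetrahedralGroup := by
  have hfin (u) (hu : u ∈ H) : IsOfFinOrder (u : ℍ[ℚ]) :=
    Units.isOfFinOrder_val.2 (H.subtype.isOfFinOrder (isOfFinOrder_of_finite (⟨u, hu⟩ : H)))
  have htrace (u) (hu : u ∈ H) : ∃ t : ℤ, 2 * (u : ℍ[ℚ]).re = t :=
    exists_two_mul_re_eq_intCast (hfin u hu)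
  intro u hu
  obtain ⟨a, ha⟩ := htrace u hu
  obtain ⟨b, hb⟩ := htrace _ (H.mul_mem hu hi)
  obtain ⟨c, hc⟩ := htrace _ (H.mul_mem hu hj)
  obtain ⟨d, hd⟩ := htrace _ (H.mul_mem hu (H.mul_mem hi hj))
  have huv : (u : ℍ[ℚ]) = halfQuaternion (a, -b, -c, -d) := by
    simp only [Units.val_mul, Quaternion.re_mul, Quaternion.imI_mul, Quaternion.imJ_mul,
      Quaternion.imK_mul] at hb hc hd
    simp only [hi', hj'] at hb hc hd
    ext <;> simp only [halfQuaternion] <;> push_cast <;> linarith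
  have hnorm := normSq_eq_one_of_isOfFinOrder (hfin u hu)
  exact ⟨huv ▸ isHurwitz_halfQuaternion (huv ▸ hnorm), hnorm⟩

end BinaryTetrahedral

section QuaternionPair

open QuaternionAlgebra (Basis)

variable {G : Type*} [Group G]

theorem nonempty_mulEquiv_of_injective_of_injective {φ : QuaternionGroup 2 →* G}
    {ψ : G →* binaryTetrahedralGroup} (hφ : Function.Injective φ) (hψ : Function.Injective ψ) :
    Nonempty (G ≃* binaryTetrahedralGroup) ∨ Nonempty (G ≃* QuaternionGroup 2) := by
  have : Finite G := Finite.of_injective ψ hψ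
  have hcard : Nat.card (QuaternionGroup 2) = 8 := by
    rw [Nat.card_eq_fintype_card, QuaternionGroup.card]
  have h8 : 8 ∣ Nat.card G := hcard ▸ Subgroup.card_dvd_of_injective φ hφ
  have h24 : Nat.card G ∣ 24 :=
    card_binaryTetrahedralGroup ▸ Subgroup.card_dvd_of_injective ψ hψ
  obtain ⟨k, hk⟩ := h8
  have hk3 : k ∣ 3 := Nat.dvd_of_mul_dvd_mul_left (by norm_num) (hk ▸ h24 : 8 * k ∣ 8 * 3)
  rcases (Nat.dvd_prime Nat.prime_three).1 hk3 with rfl | rfl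
  · exact .inr ⟨(MulEquiv.ofBijective φ (hφ.bijective_of_nat_card_le (by rw [hk, hcard]))).symm⟩
  · exact .inl ⟨MulEquiv.ofBijective ψ
      (hψ.bijective_of_nat_card_le (by rw [hk, card_binaryTetrahedralGroup]))⟩

variable {D : Type*} [Ring D] {ρ : G →* D} {x y : G}

theorem exists_injective_quaternionGroup_two_hom [IsDomain D] [CharZero D]
    (hρ : Function.Injective ρ) (hx : ρ x * ρ x = -1) (hy : ρ y * ρ y = -1)
    (hyx : ρ y * ρ x = -(ρ x * ρ y)) :
    ∃ φ : QuaternionGroup 2 →* G, Function.Injective φ := by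
  have hx0 : ρ x ≠ 0 := fun h ↦ by simp [h] at hx
  have hy0 : ρ y ≠ 0 := fun h ↦ by simp [h] at hy
  have hord : orderOf x = 2 ^ 2 := by
    refine orderOf_eq_prime_pow (p := 2) (n := 1) (fun h ↦ ?_) (hρ ?_)
    · rw [pow_one, sq] at h
      rw [← map_mul, h, map_one, self_eq_neg] at hx
      exact one_ne_zero hx
    · rw [map_pow, map_one, pow_succ, pow_one, pow_mul, sq, sq, hx, neg_mul_neg, one_mul]
  have hxinv : ρ x⁻¹ = -ρ x := by
    refine mul_left_cancel₀ hx0 ?_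
    rw [← map_mul, mul_inv_cancel, map_one, mul_neg, hx, neg_neg]
  obtain ⟨φ, hφ, -⟩ := exists_injective_quaternionGroup_hom (n := 2) (ζ := x) (x := y) hord
    (hρ (by rw [map_pow, map_pow, sq, sq, hx, hy]))
    (hρ (by rw [map_mul, map_mul, hxinv, mul_neg, hyx, neg_neg]))
    (fun h ↦ by
      rw [← hρ.eq_iff, map_mul, map_mul, hyx, self_eq_neg] at h
      exact mul_ne_zero hx0 hy0 h)
  exact ⟨φ, hφ⟩

variable [Algebra ℚ D]

theorem exists_algEquiv_quaternion [Nontrivial D] (hD : Module.finrank ℚ D = 4) {i j : D}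
    (hi : i * i = -1) (hj : j * j = -1) (hij : j * i = -(i * j)) :
    ∃ e : ℍ[ℚ] ≃ₐ[ℚ] D, e ⟨0, 1, 0, 0⟩ = i ∧ e ⟨0, 0, 1, 0⟩ = j := by
  let q : Basis (R := ℚ) D (-1) 0 (-1) := basisOfAnticommute
    (by rw [hi, map_neg, map_one]) (by rw [hj, map_neg, map_one]) hij
  let f : ℍ[ℚ] →ₐ[ℚ] D := q.liftHom
  have hf : Function.Bijective f :=
    liftHom_bijective_of_finrank_eq_four hD q (by norm_num) (by norm_num)
  have hq : (Basis.self ℚ).compHom f = q := QuaternionAlgebra.lift.symm_apply_apply q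
  exact ⟨AlgEquiv.ofBijective f hf, congrArg Basis.i hq, congrArg Basis.j hq⟩

theorem exists_injective_hom_binaryTetrahedralGroup [Nontrivial D] [Finite G]
    (hD : Module.finrank ℚ D = 4) (hρ : Function.Injective ρ) (hx : ρ x * ρ x = -1)
    (hy : ρ y * ρ y = -1) (hyx : ρ y * ρ x = -(ρ x * ρ y)) :
    ∃ ψ : G →* binaryTetrahedralGroup, Function.Injective ψ := by
  obtain ⟨e, hei, hej⟩ := exists_algEquiv_quaternion hD hx hy hyx
  let ψ : G →* ℍ[ℚ]ˣ := MonoidHom.toHomUnits ((e.symm : D →* ℍ[ℚ]).comp ρ)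
  have hψ : Function.Injective ψ := fun g h hgh ↦ hρ (e.symm.injective (congrArg Units.val hgh))
  have : Finite ψ.range := Finite.of_surjective _ ψ.rangeRestrict_surjective
  have hle : ψ.range ≤ binaryTetrahedralGroup :=
    le_binaryTetrahedralGroup (i := ψ x) (j := ψ y) ⟨x, rfl⟩ ⟨y, rfl⟩
      (e.symm_apply_eq.2 hei.symm) (e.symm_apply_eq.2 hej.symm)
  exact ⟨ψ.codRestrict _ fun g ↦ hle ⟨g, rfl⟩, (ψ.injective_codRestrict _ _).2 hψ⟩

end QuaternionPair

section Traces

variable {G D : Type*} [Group G] [Ring D]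

/-- The element `ρ g` has reduced norm one and reduced trace `t`: its conjugate is then `ρ g⁻¹`, so
that the condition makes sense without a reduced trace on `D`. -/
def HasTrace (ρ : G →* D) (g : G) (t : ℤ) : Prop := ρ g + ρ g⁻¹ = t

variable {ρ : G →* D} {g h x y ω : G} {a b s t : ℤ}

theorem hasTrace_iff_mul_self : HasTrace ρ g t ↔ ρ g * ρ g + 1 = t * ρ g := by
  have hmul_inv : ρ g * ρ g⁻¹ = 1 := map_mul_eq_one ρ (mul_inv_cancel g)
  have hinv_mul : ρ g⁻¹ * ρ g = 1 := map_mul_eq_one ρ (inv_mul_cancel g)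
  constructor
  · intro h
    rw [← (h : ρ g + ρ g⁻¹ = t), add_mul, hinv_mul]
  · intro h
    calc ρ g + ρ g⁻¹ = (ρ g * ρ g + 1) * ρ g⁻¹ := by rw [add_mul, mul_assoc, hmul_inv, mul_one,
          one_mul]
      _ = t := by rw [h, mul_assoc, hmul_inv, mul_one]

theorem hasTrace_zero_iff : HasTrace ρ g 0 ↔ ρ g * ρ g = -1 := by
  rw [hasTrace_iff_mul_self, Int.cast_zero, zero_mul, eq_neg_iff_add_eq_zero]

theorem hasTrace_one : HasTrace ρ 1 2 := by
  rw [HasTrace, inv_one, map_one, one_add_one_eq_two, Int.cast_two]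

theorem HasTrace.inv (hg : HasTrace ρ g t) : HasTrace ρ g⁻¹ t := by
  rw [HasTrace, inv_inv, add_comm]
  exact hg

theorem HasTrace.conj (hg : HasTrace ρ g t) (h : G) : HasTrace ρ (h * g * h⁻¹) t := by
  rw [HasTrace, conj_inv, map_mul, map_mul, map_mul, map_mul, ← add_mul, ← mul_add,
    (hg : ρ g + ρ g⁻¹ = t), ← Int.cast_comm, mul_assoc, map_mul_eq_one ρ (mul_inv_cancel h),
    mul_one]

theorem HasTrace.map_inv_of_zero (hg : HasTrace ρ g 0) : ρ g⁻¹ = -ρ g :=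
  (neg_eq_of_add_eq_zero_right (hg.trans Int.cast_zero)).symm

theorem HasTrace.anticommute (hx : HasTrace ρ x 0) (hy : HasTrace ρ y 0)
    (hxy : HasTrace ρ (x * y) 0) : ρ y * ρ x = -(ρ x * ρ y) := by
  rw [← map_mul ρ x y, ← hxy.map_inv_of_zero, mul_inv_rev, map_mul ρ y⁻¹, hx.map_inv_of_zero,
    hy.map_inv_of_zero, neg_mul_neg]

theorem HasTrace.map_sq_of_zero (hg : HasTrace ρ g 0) : ρ (g ^ 2) = -1 := by
  rw [sq, map_mul, hasTrace_zero_iff.1 hg]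

theorem HasTrace.sq_sq (hρ : Function.Injective ρ) (hg : HasTrace ρ g 0) : (g ^ 2) ^ 2 = 1 :=
  hρ (by rw [map_pow, hg.map_sq_of_zero, neg_one_sq, map_one])

theorem HasTrace.pow_three (hρ : Function.Injective ρ) (hg : HasTrace ρ g (-1)) : g ^ 3 = 1 := by
  have hsq : ρ g * ρ g = -1 - ρ g := by
    rw [eq_sub_iff_add_eq, eq_neg_iff_add_eq_zero, add_right_comm, hasTrace_iff_mul_self.1 hg,
      Int.cast_neg, Int.cast_one, neg_one_mul, neg_add_cancel]
  refine hρ ?_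
  rw [map_pow, map_one, pow_succ, sq, hsq, sub_mul, hsq]
  noncomm_ring

theorem HasTrace.add_eq_mul [CharZero D] (hx : HasTrace ρ x a) (hy : HasTrace ρ y b)
    (hs : HasTrace ρ (x * y) s) (ht : HasTrace ρ (x * y⁻¹) t) : s + t = a * b := by
  have hcast : (s + t : D) = a * b :=
    calc (s + t : D) = ρ (x * y) + ρ (x * y)⁻¹ + (ρ (x * y⁻¹) + ρ (x * y⁻¹)⁻¹) :=
          (congrArg₂ (· + ·) hs ht).symm
      _ = ρ x * (ρ y + ρ y⁻¹) + (ρ y + ρ y⁻¹) * ρ x⁻¹ := by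
          simp only [mul_inv_rev, inv_inv, map_mul]; noncomm_ring
      _ = (ρ x + ρ x⁻¹) * b := by rw [(hy : ρ y + ρ y⁻¹ = b), Int.cast_comm b (ρ x⁻¹), add_mul]
      _ = a * b := by rw [(hx : ρ x + ρ x⁻¹ = a)]
  exact_mod_cast hcast

theorem HasTrace.eq_one [IsDomain D] (hρ : Function.Injective ρ) (hg : HasTrace ρ g 2) :
    g = 1 := by
  have hsq : (ρ g - 1) * (ρ g - 1) = ρ g * ρ g + 1 - (2 : ℤ) * ρ g := by
    push_cast; noncomm_ring
  rw [hasTrace_iff_mul_self.1 hg, sub_self, mul_self_eq_zero, sub_eq_zero] at hsq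
  exact hρ (hsq.trans (map_one ρ).symm)

theorem HasTrace.map_eq_neg_one [IsDomain D] (hg : HasTrace ρ g (-2)) : ρ g = -1 := by
  have hsq : (ρ g + 1) * (ρ g + 1) = ρ g * ρ g + 1 - (-2 : ℤ) * ρ g := by
    push_cast; noncomm_ring
  rw [hasTrace_iff_mul_self.1 hg, sub_self, mul_self_eq_zero] at hsq
  exact eq_neg_of_add_eq_zero_left hsq

theorem HasTrace.map_eq_neg_of_one (hg : HasTrace ρ g 1) : ρ g = -ρ (g * g * (g * g)) := by
  have hsq : ρ g * ρ g = ρ g - 1 := by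
    rw [eq_sub_iff_add_eq, hasTrace_iff_mul_self.1 hg, Int.cast_one, one_mul]
  rw [map_mul, map_mul, hsq, sub_mul, mul_sub, hsq]
  noncomm_ring

theorem HasTrace.eq_or_eq_inv_of_commute [IsDomain D] (hρ : Function.Injective ρ)
    (hω : HasTrace ρ ω t) (hg : HasTrace ρ g t) (hc : Commute g ω) : g = ω ∨ g = ω⁻¹ := by
  have hprod : (ρ g - ρ ω) * (ρ g - ρ ω⁻¹) = 0 :=
    calc (ρ g - ρ ω) * (ρ g - ρ ω⁻¹)
        = ρ g * ρ g + ρ ω * ρ ω⁻¹ - (ρ g * ρ ω⁻¹ + ρ ω * ρ g) := by noncomm_ring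
      _ = ρ g * ρ g + 1 - ρ g * (ρ ω + ρ ω⁻¹) := by
          rw [map_mul_eq_one ρ (mul_inv_cancel ω), ← (hc.map ρ).eq, add_comm (ρ g * ρ ω⁻¹), mul_add]
      _ = 0 := by
          rw [(hω : ρ ω + ρ ω⁻¹ = t), hasTrace_iff_mul_self.1 hg, Int.cast_comm, sub_self]
  exact (mul_eq_zero.1 hprod).imp (fun h ↦ hρ (sub_eq_zero.1 h)) fun h ↦ hρ (sub_eq_zero.1 h)

theorem commute_of_map_eq_neg_one (hρ : Function.Injective ρ) (hg : ρ g = -1) (x : G) :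
    Commute g x :=
  hρ (by rw [map_mul, map_mul, hg, neg_one_mul, mul_neg_one])

/-- All traces of the group are integers between `-2` and `2`, as those of a finite group of
elements of degree at most two over `ℚ` are. -/
def HasBoundedTraces (ρ : G →* D) : Prop := ∀ g, ∃ t : ℤ, -2 ≤ t ∧ t ≤ 2 ∧ HasTrace ρ g t

/-- No two elements of the group are anticommuting square roots of `-1`. -/
def HasNoQuaternionPair (ρ : G →* D) : Prop :=
  ∀ x y, HasTrace ρ x 0 → HasTrace ρ y 0 → ¬HasTrace ρ (x * y) 0

theorem HasNoQuaternionPair.not_hasTrace_mul_zero (hQ : HasNoQuaternionPair ρ)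
    (hρ : Function.Injective ρ) (hx : HasTrace ρ x (-1)) (hy : HasTrace ρ y (-1)) :
    ¬HasTrace ρ (x * y) 0 := by
  intro hxy
  have hconj : x * y * (x * (x * y) * x⁻¹) = x * y⁻¹ * (x * y)⁻¹ * (x * y⁻¹)⁻¹ := by
    have hx2 : x * x = x⁻¹ := by rw [eq_inv_iff_mul_eq_one, ← sq, ← pow_succ, hx.pow_three hρ]
    have hy2 : y = y⁻¹ * y⁻¹ := by
      rw [← mul_inv_rev, eq_inv_iff_mul_eq_one, ← sq, ← pow_succ', hy.pow_three hρ]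
    calc x * y * (x * (x * y) * x⁻¹) = x * y * (x * x) * y * x⁻¹ := by group
      _ = x * (y⁻¹ * y⁻¹) * x⁻¹ * y * x⁻¹ := by rw [hx2, ← hy2]
      _ = x * y⁻¹ * (x * y)⁻¹ * (x * y⁻¹)⁻¹ := by group
  exact hQ _ _ hxy (hxy.conj x) (hconj ▸ hxy.inv.conj _)

theorem HasTrace.sq_mul_pow_three (hρ : Function.Injective ρ) (hω : HasTrace ρ ω (-1))
    (hx : HasTrace ρ x 0) (hc : Commute (x ^ 2) ω) : (x ^ 2 * ω) ^ 3 = x ^ 2 := by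
  rw [hc.mul_pow, hω.pow_three hρ, mul_one, pow_succ, hx.sq_sq hρ, one_mul]

variable [CharZero D]

theorem HasBoundedTraces.hasTrace_mul_self_of_one (hT : HasBoundedTraces ρ)
    (hg : HasTrace ρ g 1) : HasTrace ρ (g * g) (-1) := by
  obtain ⟨s, -, -, hs⟩ := hT (g * g)
  have hsum := hg.add_eq_mul hg hs (mul_inv_cancel g ▸ hasTrace_one)
  obtain rfl : s = -1 := by linarith
  exact hs

theorem HasBoundedTraces.not_hasTrace_zero_of_commute (hT : HasBoundedTraces ρ)
    (hρ : Function.Injective ρ) (hω : HasTrace ρ ω (-1)) (hc : Commute g ω) :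
    ¬HasTrace ρ g 0 := by
  intro hg
  obtain ⟨s, hs_ge, hs_le, hs⟩ := hT (g * ω)
  have hsq : ρ (g * ω * (g * ω)) = -ρ ω⁻¹ := by
    have hω2 : ω * ω = ω⁻¹ := by rw [eq_inv_iff_mul_eq_one, ← sq, ← pow_succ, hω.pow_three hρ]
    rw [hc.symm.mul_mul_mul_comm, hω2, map_mul, map_mul, hasTrace_zero_iff.1 hg, neg_one_mul]
  have htrace : HasTrace ρ (g * ω * (g * ω)) 1 := by
    rw [hasTrace_iff_mul_self, hsq, neg_mul_neg, hasTrace_iff_mul_self.1 hω.inv, Int.cast_neg,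
      Int.cast_one, neg_one_mul, one_mul]
  have hsum := hs.add_eq_mul hs htrace (mul_inv_cancel (g * ω) ▸ hasTrace_one)
  interval_cases s <;> omega

theorem orderOf_of_hasTrace_neg_one (hρ : Function.Injective ρ) (hω : HasTrace ρ ω (-1)) :
    orderOf ω = 3 := by
  refine orderOf_eq_prime (hω.pow_three hρ) ?_
  rintro rfl
  have htwo : ((2 : ℤ) : D) = (-1 : ℤ) := hasTrace_one.symm.trans hω
  have : (2 : ℤ) = -1 := by exact_mod_cast htwo
  omega

variable [IsDomain D]

theorem HasNoQuaternionPair.commute (hQ : HasNoQuaternionPair ρ) (hρ : Function.Injective ρ)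
    (hT : HasBoundedTraces ρ) (hx : HasTrace ρ x (-1)) (hy : HasTrace ρ y (-1)) :
    Commute x y := by
  obtain ⟨s, hs_ge, hs_le, hs⟩ := hT (x * y)
  obtain ⟨t, ht_ge, ht_le, ht⟩ := hT (x * y⁻¹)
  have hsum : s + t = -1 * -1 := hx.add_eq_mul hy hs ht
  have hs0 : s ≠ 0 := by rintro rfl; exact hQ.not_hasTrace_mul_zero hρ hx hy hs
  have ht0 : t ≠ 0 := by rintro rfl; exact hQ.not_hasTrace_mul_zero hρ hx hy.inv ht
  obtain rfl | rfl : s = 2 ∨ t = 2 := by omega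
  · rw [eq_inv_of_mul_eq_one_left (hs.eq_one hρ)]
    exact (Commute.refl y).inv_left
  · rw [mul_inv_eq_one.1 (ht.eq_one hρ)]

theorem HasBoundedTraces.exists_map_eq_zpow_of_commute (hT : HasBoundedTraces ρ)
    (hρ : Function.Injective ρ) (hω : HasTrace ρ ω (-1)) (hc : Commute g ω) :
    ∃ k : ℤ, ρ g = ρ (ω ^ k) ∨ ρ g = -ρ (ω ^ k) := by
  obtain ⟨t, ht_ge, ht_le, ht⟩ := hT g
  interval_cases t
  · exact ⟨0, .inr (by rw [zpow_zero, map_one, ht.map_eq_neg_one])⟩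
  · rcases hω.eq_or_eq_inv_of_commute hρ ht hc with rfl | rfl
    · exact ⟨1, .inl (by rw [zpow_one])⟩
    · exact ⟨-1, .inl (by rw [zpow_neg_one])⟩
  · exact absurd ht (hT.not_hasTrace_zero_of_commute hρ hω hc)
  · rcases hω.eq_or_eq_inv_of_commute hρ (hT.hasTrace_mul_self_of_one ht) (hc.mul_left hc)
      with h | h
    · exact ⟨2, .inr (by rw [ht.map_eq_neg_of_one, h, ← zpow_two])⟩
    · exact ⟨-2, .inr (by rw [ht.map_eq_neg_of_one, h, ← zpow_two, inv_zpow'])⟩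
  · exact ⟨0, .inl (by rw [zpow_zero, ht.eq_one hρ])⟩

end Traces

section Dicyclic

variable {G D : Type*} [Group G] [Ring D] [IsDomain D] [CharZero D] {ρ : G →* D} {g x y ω : G}

theorem orderOf_sq_of_hasTrace_zero (hρ : Function.Injective ρ) (hx : HasTrace ρ x 0) :
    orderOf (x ^ 2) = 2 := by
  refine orderOf_eq_prime (hx.sq_sq hρ) fun h ↦ ?_
  have hsq := hx.map_sq_of_zero
  rw [h, map_one, self_eq_neg] at hsq
  exact one_ne_zero hsq

theorem orderOf_sq_mul (hρ : Function.Injective ρ) (hω : HasTrace ρ ω (-1))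
    (hx : HasTrace ρ x 0) (hc : Commute (x ^ 2) ω) : orderOf (x ^ 2 * ω) = 2 * 3 := by
  have h2 := orderOf_sq_of_hasTrace_zero hρ hx
  have h3 := orderOf_of_hasTrace_neg_one hρ hω
  rw [hc.orderOf_mul_eq_mul_orderOf_of_coprime (by rw [h2, h3]; norm_num), h2, h3]

theorem HasNoQuaternionPair.commute_or_semiconjBy_inv (hQ : HasNoQuaternionPair ρ)
    (hρ : Function.Injective ρ) (hT : HasBoundedTraces ρ) (hω : HasTrace ρ ω (-1)) (g : G) :
    Commute g ω ∨ SemiconjBy g ω ω⁻¹ :=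
  (hω.eq_or_eq_inv_of_commute hρ (hω.conj g) (hQ.commute hρ hT (hω.conj g) hω)).imp
    mul_inv_eq_iff_eq_mul.1 mul_inv_eq_iff_eq_mul.1

theorem HasNoQuaternionPair.exists_hasTrace_neg_one (hQ : HasNoQuaternionPair ρ)
    (hρ : Function.Injective ρ) (hT : HasBoundedTraces ρ) (hxy : ¬Commute x y) :
    ∃ ω, HasTrace ρ ω (-1) := by
  by_contra! hno
  have htrace (g : G) : HasTrace ρ g 0 ∨ g = 1 ∨ ρ g = -1 := by
    obtain ⟨t, ht_ge, ht_le, ht⟩ := hT g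
    interval_cases t
    · exact .inr (.inr ht.map_eq_neg_one)
    · exact absurd ht (hno g)
    · exact .inl ht
    · exact absurd (hT.hasTrace_mul_self_of_one ht) (hno _)
    · exact .inr (.inl (ht.eq_one hρ))
  have hzero {g h : G} (hgh : ¬Commute g h) : HasTrace ρ g 0 := by
    rcases htrace g with hg | rfl | hg
    · exact hg
    · exact absurd (Commute.one_left h) hgh
    · exact absurd (commute_of_map_eq_neg_one hρ hg h) hgh
  have hcomm : ¬Commute (x * y) y := fun h ↦
    hxy (by simpa only [mul_inv_cancel_right] using h.mul_left (Commute.refl y).inv_left)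
  exact hQ x y (hzero hxy) (hzero fun h ↦ hxy h.symm) (hzero hcomm)

theorem HasBoundedTraces.exists_not_commute (hT : HasBoundedTraces ρ)
    (hρ : Function.Injective ρ) (hω : HasTrace ρ ω (-1)) (hxy : ¬Commute x y) :
    ∃ g, ¬Commute g ω := by
  by_contra! hcomm
  obtain ⟨k, hk⟩ := hT.exists_map_eq_zpow_of_commute hρ hω (hcomm x)
  obtain ⟨l, hl⟩ := hT.exists_map_eq_zpow_of_commute hρ hω (hcomm y)
  have hkl : Commute (ρ (ω ^ k)) (ρ (ω ^ l)) := (Commute.zpow_zpow_self ω k l).map ρ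
  refine hxy (hρ ?_)
  rw [map_mul, map_mul]
  rcases hk with hk | hk <;> rcases hl with hl | hl <;> rw [hk, hl]
  · exact hkl.eq
  · exact hkl.neg_right.eq
  · exact hkl.neg_left.eq
  · exact hkl.neg_left.neg_right.eq

theorem HasNoQuaternionPair.hasTrace_zero_of_not_commute (hQ : HasNoQuaternionPair ρ)
    (hρ : Function.Injective ρ) (hT : HasBoundedTraces ρ) (hω : HasTrace ρ ω (-1))
    (hx : ¬Commute x ω) : HasTrace ρ x 0 := by
  obtain ⟨t, ht_ge, ht_le, ht⟩ := hT x
  interval_cases t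
  · exact absurd (commute_of_map_eq_neg_one hρ ht.map_eq_neg_one ω) hx
  · exact absurd (hQ.commute hρ hT ht hω) hx
  · exact ht
  · have hsq : Commute (x * x) ω := hQ.commute hρ hT (hT.hasTrace_mul_self_of_one ht) hω
    have hmap : Commute (ρ x) (ρ ω) :=
      ht.map_eq_neg_of_one ▸ ((hsq.mul_left hsq).map ρ).neg_left
    exact absurd (hρ (by rw [map_mul, map_mul, hmap.eq])) hx
  · exact absurd (ht.eq_one hρ ▸ Commute.one_left ω) hx

theorem HasBoundedTraces.exists_eq_zpow_of_commute (hT : HasBoundedTraces ρ)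
    (hρ : Function.Injective ρ) (hω : HasTrace ρ ω (-1)) (hx : HasTrace ρ x 0)
    (hxω : Commute (x ^ 2) ω) (hc : Commute g ω) : ∃ k : ℤ, g = (x ^ 2 * ω) ^ k := by
  have hpow_three : (x ^ 2 * ω) ^ 3 = x ^ 2 := hω.sq_mul_pow_three hρ hx hxω
  have hpow_four : (x ^ 2 * ω) ^ 4 = ω := by
    rw [pow_succ, hpow_three, ← mul_assoc, ← sq, hx.sq_sq hρ, one_mul]
  obtain ⟨k, hk | hk⟩ := hT.exists_map_eq_zpow_of_commute hρ hω hc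
  · refine ⟨4 * k, hρ ?_⟩
    rw [hk, zpow_mul, zpow_ofNat, hpow_four]
  · refine ⟨3 + 4 * k, hρ ?_⟩
    rw [hk, zpow_add, zpow_mul, zpow_ofNat, zpow_ofNat, hpow_three, hpow_four, map_mul,
      hx.map_sq_of_zero, neg_one_mul]

theorem HasNoQuaternionPair.nonempty_mulEquiv_quaternionGroup_three (hQ : HasNoQuaternionPair ρ)
    (hρ : Function.Injective ρ) (hT : HasBoundedTraces ρ) (hxy : ¬Commute x y) :
    Nonempty (G ≃* QuaternionGroup 3) := by
  obtain ⟨ω, hω⟩ := hQ.exists_hasTrace_neg_one hρ hT hxy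
  obtain ⟨x, hxω⟩ := hT.exists_not_commute hρ hω hxy
  have hx0 : HasTrace ρ x 0 := hQ.hasTrace_zero_of_not_commute hρ hT hω hxω
  have hx2 : ∀ g, Commute (x ^ 2) g :=
    commute_of_map_eq_neg_one hρ hx0.map_sq_of_zero
  have hinv : SemiconjBy x ω ω⁻¹ := (hQ.commute_or_semiconjBy_inv hρ hT hω x).resolve_left hxω
  have hζ_inv : SemiconjBy x (x ^ 2 * ω) (x ^ 2 * ω)⁻¹ := by
    have hx2_inv : (x ^ 2)⁻¹ = x ^ 2 := inv_eq_of_mul_eq_one_left (by rw [← sq, hx0.sq_sq hρ])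
    rw [(hx2 ω).mul_inv, hx2_inv]
    exact SemiconjBy.mul_right (hx2 x).symm hinv
  obtain ⟨φ, hφ_inj, hφ⟩ := exists_injective_quaternionGroup_hom (n := 3) (x := x)
    (orderOf_sq_mul hρ hω hx0 (hx2 ω)) (hω.sq_mul_pow_three hρ hx0 (hx2 ω)).symm
    (by simpa only [inv_inv] using hζ_inv.inv_right.eq.symm)
    (fun h ↦ hxω (by
      simpa only [inv_mul_cancel_left] using
        (hx2 x).symm.inv_right.mul_right (show Commute x (x ^ 2 * ω) from h.symm)))
  refine ⟨(MulEquiv.ofBijective φ ⟨hφ_inj, fun g ↦ ?_⟩).symm⟩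
  rcases hQ.commute_or_semiconjBy_inv hρ hT hω g with hg | hg
  · obtain ⟨k, rfl⟩ := hT.exists_eq_zpow_of_commute hρ hω hx0 (hx2 ω) hg
    exact ⟨_, (hφ k).1⟩
  · obtain ⟨k, hk⟩ := hT.exists_eq_zpow_of_commute hρ hω hx0 (hx2 ω)
      (hinv.inv_symm_left.mul_left hg)
    exact ⟨.xa k, by rw [(hφ k).2, ← hk, mul_inv_cancel_left]⟩

end Dicyclic

theorem isCyclic_of_injective_of_commute {G D : Type*} [Group G] [Finite G] [Ring D] [IsDomain D]
    {ρ : G →* D} (hρ : Function.Injective ρ) (hc : ∀ x y : G, Commute x y) : IsCyclic G := by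
  let K := Algebra.adjoin ℤ (Set.range ρ)
  have : IsMulCommutative K := Algebra.isMulCommutative_adjoin ℤ (by
    rintro _ ⟨x, rfl⟩ _ ⟨y, rfl⟩
    exact (hc x y).map ρ)
  let _ : CommRing K := { (inferInstance : Ring K) with mul_comm := mul_comm' }
  let f : G →* K := ρ.codRestrict K fun g ↦ Algebra.subset_adjoin ⟨g, rfl⟩
  have hf : Function.Injective f := fun x y h ↦ hρ (congrArg (Subtype.val : K → D) h)
  exact isCyclic_of_injective_ringHom (R := K) f hf

section Classification

variable {D : Type*} [Ring D] [IsDomain D]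

theorem mul_self_eq_sub_one_of_pow_three {z : D} (hz : z ^ 3 = -1) (hne : z ≠ -1) :
    z * z = z - 1 := by
  have hprod : (z + 1) * (z * z - z + 1) = 0 := by
    calc (z + 1) * (z * z - z + 1) = z ^ 3 + 1 := by rw [pow_succ, sq]; noncomm_ring
      _ = 0 := by rw [hz, neg_add_cancel]
  have hquad := (mul_eq_zero.1 hprod).resolve_left fun h ↦ hne (eq_neg_of_add_eq_zero_left h)
  linear_combination (norm := abel) hquad

variable [Algebra ℚ D]

theorem hasQuaternionBasis_of_quaternionGroup_three {f : QuaternionGroup 3 →* D}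
    (hf : Function.Injective f) : HasQuaternionBasis D (-1 : ℚ) (-3) := by
  have hone {g : QuaternionGroup 3} (hg : g ≠ 1) : f g ≠ 1 := (map_ne_one_iff f hf).2 hg
  have ha3 : f (.a 3) = -1 :=
    (mul_self_eq_one_iff.1 (map_mul_eq_one f (by decide))).resolve_left (hone (by decide))
  have hz : f (.a 1) * f (.a 1) = f (.a 1) - 1 :=
    mul_self_eq_sub_one_of_pow_three (by rw [← map_pow, ← ha3]; rfl)
      (ha3 ▸ hf.ne (by decide))
  have hzx : f (.a 1) * f (.xa 0) = f (.xa 0) * (1 - f (.a 1)) :=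
    calc f (.a 1) * f (.xa 0) = f (.a 1 * .xa 0) := (map_mul f _ _).symm
      _ = f (.xa 0 * (.a 3 * (.a 1 * .a 1))) := congrArg f (by decide)
      _ = f (.xa 0) * (1 - f (.a 1)) := by
        rw [map_mul, map_mul, map_mul, ha3, hz, neg_one_mul, neg_sub]
  refine .of_anticommute (i := f (.xa 0)) (j := 2 * f (.a 1) - 1) ?_ ?_ ?_
  · rw [← map_mul, map_neg, map_one, ← ha3]
    rfl
  · calc (2 * f (.a 1) - 1) * (2 * f (.a 1) - 1)
        = 4 * (f (.a 1) * f (.a 1)) - 4 * f (.a 1) + 1 := by noncomm_ring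
      _ = -3 := by rw [hz, mul_sub, mul_one, sub_right_comm, sub_self]; norm_num
      _ = algebraMap ℚ D (-3) := by rw [map_neg, map_ofNat]
  · rw [sub_mul, mul_assoc, hzx]
    noncomm_ring

theorem exists_noncommutative_quaternionGroup_three_hom (hD : HasQuaternionBasis D (-1 : ℚ) (-3)) :
    ∃ f : QuaternionGroup 3 →* Dˣ, ¬Commute (f (.a 1)) (f (.xa 0)) := by
  obtain ⟨q⟩ := hD
  let ζ : ℍ[ℚ,-1,-3]ˣ := ⟨⟨1 / 2, 0, 1 / 2, 0⟩, ⟨1 / 2, 0, -1 / 2, 0⟩,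
    by ext <;> simp <;> norm_num, by ext <;> simp <;> norm_num⟩
  let x : ℍ[ℚ,-1,-3]ˣ := ⟨⟨0, 1, 0, 0⟩, ⟨0, -1, 0, 0⟩, by ext <;> simp, by ext <;> simp⟩
  have hζ : ζ ^ 3 = -1 := by
    rw [Units.ext_iff, pow_succ, sq]
    ext <;> simp [ζ] <;> norm_num
  have hx : x ^ 2 = -1 := by
    rw [Units.ext_iff, sq]
    ext <;> simp [x]
  have hζx : ζ * x = x * ζ⁻¹ := by
    rw [Units.ext_iff]
    ext <;> simp [x, ζ]
    norm_num
  obtain ⟨φ, hφ⟩ := exists_quaternionGroup_hom (n := 3)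
    (by rw [mul_comm, pow_mul, hζ, neg_one_sq]) (hx.trans hζ.symm) hζx
  have hφ_a : φ (.a 1) = ζ := by simpa using (hφ 1).1
  have hφ_xa : φ (.xa 0) = x := by simpa using (hφ 0).2
  refine ⟨(Units.map (q.liftHom : ℍ[ℚ,-1,-3] →* D)).comp φ, fun hcomm ↦ ?_⟩
  have hinj := Units.map_injective (liftHom_injective_of_ne_zero q (by norm_num) (by norm_num))
  have hζx_comm : Commute ζ x := hφ_a ▸ hφ_xa ▸ Commute.of_map hinj hcomm
  have himK := congrArg (fun u : ℍ[ℚ,-1,-3]ˣ ↦ (u : ℍ[ℚ,-1,-3]).imK) hζx_comm.eq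
  norm_num [ζ, x] at himK

theorem hasBoundedTraces_of_finrank_eq_four {G : Type*} [Group G] [Finite G]
    [Algebra.IsCentral ℚ D] (hD : Module.finrank ℚ D = 4) (ρ : G →* D) : HasBoundedTraces ρ := by
  intro g
  obtain ⟨t, ht_ge, ht_le, ht⟩ := exists_int_mul_self_add_one_eq_mul
    (ρ.isOfFinOrder (isOfFinOrder_of_finite g)) (natDegree_minpoly_le_two hD _)
  exact ⟨t, ht_ge, ht_le, hasTrace_iff_mul_self.2 ht⟩

theorem finite_group_classification {G : Type*} [Group G] [Finite G] [Algebra.IsCentral ℚ D]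
    (hD : Module.finrank ℚ D = 4) {ρ : G →* D} (hρ : Function.Injective ρ) :
    (HasQuaternionBasis D (-1 : ℚ) (-1) ∧
      (Nonempty (G ≃* binaryTetrahedralGroup) ∨ Nonempty (G ≃* QuaternionGroup 2))) ∨
    (HasQuaternionBasis D (-1 : ℚ) (-3) ∧ Nonempty (G ≃* QuaternionGroup 3)) ∨ IsCyclic G := by
  have : CharZero D := algebraRat.charZero D
  have hT : HasBoundedTraces ρ := hasBoundedTraces_of_finrank_eq_four hD ρ
  by_cases hQ : HasNoQuaternionPair ρ
  · by_cases hcomm : ∀ x y : G, Commute x y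
    · exact .inr (.inr (isCyclic_of_injective_of_commute hρ hcomm))
    push Not at hcomm
    obtain ⟨x, y, hxy⟩ := hcomm
    obtain ⟨e⟩ := hQ.nonempty_mulEquiv_quaternionGroup_three hρ hT hxy
    exact .inr (.inl ⟨hasQuaternionBasis_of_quaternionGroup_three
      (f := ρ.comp (e.symm : QuaternionGroup 3 →* G)) (hρ.comp e.symm.injective), ⟨e⟩⟩)
  · simp only [HasNoQuaternionPair, not_forall, not_not] at hQ
    obtain ⟨x, y, hx, hy, hxy⟩ := hQ
    have hyx := hx.anticommute hy hxy
    rw [hasTrace_zero_iff] at hx hy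
    obtain ⟨φ, hφ⟩ := exists_injective_quaternionGroup_two_hom hρ hx hy hyx
    obtain ⟨ψ, hψ⟩ := exists_injective_hom_binaryTetrahedralGroup hD hρ hx hy hyx
    exact .inl ⟨.of_anticommute (by rw [hx, map_neg, map_one]) (by rw [hy, map_neg, map_one]) hyx,
      nonempty_mulEquiv_of_injective_of_injective hφ hψ⟩

end Classification

section Jordan

/-- `H` has an abelian normal subgroup of index at most `d`. This is meant for finite groups `H`
only, as an infinite index is `0`. -/
def HasAbelianNormalOfIndexLE (H : Type*) [Group H] (d : ℕ) : Prop :=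
  ∃ A : Subgroup H, A.Normal ∧ (∀ x ∈ A, ∀ y ∈ A, x * y = y * x) ∧ A.index ≤ d

variable {H K : Type*} [Group H] [Group K] {d e : ℕ}

theorem HasAbelianNormalOfIndexLE.of_equiv (h : HasAbelianNormalOfIndexLE H d) (f : K ≃* H) :
    HasAbelianNormalOfIndexLE K d := by
  obtain ⟨A, hA, hcomm, hidx⟩ := h
  refine ⟨A.comap (f : K →* H), hA.comap _, fun x hx y hy ↦ f.injective ?_, ?_⟩
  · rw [map_mul, map_mul]
    exact hcomm _ hx _ hy
  · rwa [Subgroup.index_comap_of_surjective _ f.surjective]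

theorem HasAbelianNormalOfIndexLE.mono (h : HasAbelianNormalOfIndexLE H d) (hde : d ≤ e) :
    HasAbelianNormalOfIndexLE H e := by
  obtain ⟨A, hA, hcomm, hidx⟩ := h
  exact ⟨A, hA, hcomm, hidx.trans hde⟩

theorem HasAbelianNormalOfIndexLE.mul_comm [Finite H] (h : HasAbelianNormalOfIndexLE H 1)
    (x y : H) : x * y = y * x := by
  obtain ⟨A, -, hcomm, hidx⟩ := h
  obtain rfl : A = ⊤ := Subgroup.index_eq_one.1
    (hidx.antisymm (Nat.one_le_iff_ne_zero.2 A.index_ne_zero_of_finite))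
  exact hcomm x trivial y trivial

theorem hasAbelianNormalOfIndexLE_of_isCyclic [IsCyclic H] : HasAbelianNormalOfIndexLE H 1 := by
  let := IsCyclic.commGroup (α := H)
  exact ⟨⊤, inferInstance, fun x _ y _ ↦ _root_.mul_comm x y, Subgroup.index_top.le⟩

theorem zpowers_mul_comm (g : H) :
    ∀ x ∈ Subgroup.zpowers g, ∀ y ∈ Subgroup.zpowers g, x * y = y * x := by
  rintro _ ⟨k, rfl⟩ _ ⟨l, rfl⟩
  exact Commute.zpow_zpow_self g k l

theorem normal_of_le_center {A : Subgroup H} (hA : A ≤ Subgroup.center H) : A.Normal where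
  conj_mem a ha g := by rwa [Subgroup.mem_center_iff.1 (hA ha) g, mul_inv_cancel_right]

theorem hasAbelianNormalOfIndexLE_quaternionGroup (n : ℕ) [NeZero n] :
    HasAbelianNormalOfIndexLE (QuaternionGroup n) 2 := by
  have hidx : (Subgroup.zpowers (QuaternionGroup.a 1 : QuaternionGroup n)).index = 2 := by
    have hmul := (Subgroup.zpowers (QuaternionGroup.a 1 : QuaternionGroup n)).card_mul_index
    rw [Nat.card_zpowers, QuaternionGroup.orderOf_a_one, Nat.card_eq_fintype_card,
      QuaternionGroup.card] at hmul
    have hn := NeZero.pos n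
    exact Nat.eq_of_mul_eq_mul_left (by omega : 0 < 2 * n) (by linarith)
  exact ⟨_, Subgroup.normal_of_index_eq_two hidx, zpowers_mul_comm _, hidx.le⟩

/-- The element `-1` of the binary tetrahedral group. -/
def binaryTetrahedralNegOne : binaryTetrahedralGroup :=
  ⟨-1, ⟨-1, 0, 0, 0, by simp⟩, by simp⟩

theorem coe_binaryTetrahedralNegOne :
    ((binaryTetrahedralNegOne : ℍ[ℚ]ˣ) : ℍ[ℚ]) = -1 := rfl

theorem orderOf_binaryTetrahedralNegOne : orderOf binaryTetrahedralNegOne = 2 := by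
  have : CharZero ℍ[ℚ] := algebraRat.charZero ℍ[ℚ]
  refine orderOf_eq_prime (binaryTetrahedralGroup_ext ?_) fun h ↦ ?_
  · simp [coe_binaryTetrahedralNegOne]
  · have hneg : (-1 : ℍ[ℚ]) = 1 :=
      congrArg (fun u : binaryTetrahedralGroup ↦ ((u : ℍ[ℚ]ˣ) : ℍ[ℚ])) h
    exact one_ne_zero (self_eq_neg.1 hneg.symm)

theorem zpowers_binaryTetrahedralNegOne_le_center :
    Subgroup.zpowers binaryTetrahedralNegOne ≤ Subgroup.center binaryTetrahedralGroup :=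
  Subgroup.zpowers_le.2 <| Subgroup.mem_center_iff.2 fun g ↦
    binaryTetrahedralGroup_ext (by simp [coe_binaryTetrahedralNegOne])

theorem hasAbelianNormalOfIndexLE_binaryTetrahedralGroup :
    HasAbelianNormalOfIndexLE binaryTetrahedralGroup 12 := by
  refine ⟨Subgroup.zpowers binaryTetrahedralNegOne,
    normal_of_le_center zpowers_binaryTetrahedralNegOne_le_center, zpowers_mul_comm _, ?_⟩
  have hmul := (Subgroup.zpowers binaryTetrahedralNegOne).card_mul_index
  rw [Nat.card_zpowers, orderOf_binaryTetrahedralNegOne, card_binaryTetrahedralGroup] at hmul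
  omega

/-- Conjugation by `i` negates the `j`- and `k`-coordinates, and conjugation by
`(1 + i + j + k) / 2` permutes the imaginary coordinates cyclically; a quaternion commutes with its
conjugate only if their imaginary parts are parallel. -/
theorem im_eq_zero_of_commute_conj {i w z : ℍ[ℚ]} (hi : i = ⟨0, 1, 0, 0⟩)
    (hw : w = ⟨1 / 2, 1 / 2, 1 / 2, 1 / 2⟩) (hiz : Commute (i * z * star i) z)
    (hwz : Commute (w * z * star w) z) : z.imI = 0 ∧ z.imJ = 0 ∧ z.imK = 0 := by
  have hIK := congrArg QuaternionAlgebra.imJ hiz.eq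
  have hIJ := congrArg QuaternionAlgebra.imK hiz.eq
  have hJ := congrArg QuaternionAlgebra.imI hwz.eq
  have hK := congrArg QuaternionAlgebra.imJ hwz.eq
  have hI := congrArg QuaternionAlgebra.imK hwz.eq
  simp only [Quaternion.re_mul, Quaternion.imI_mul, Quaternion.imJ_mul,
    Quaternion.imK_mul, Quaternion.re_star, Quaternion.imI_star, Quaternion.imJ_star,
    Quaternion.imK_star] at hIK hIJ hJ hK hI
  simp only [hi, hw] at hIK hIJ hJ hK hI
  ring_nf at hIK hIJ hJ hK hI
  replace hIK : z.imI * z.imK = 0 := by linarith only [hIK]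
  replace hIJ : z.imI * z.imJ = 0 := by linarith only [hIJ]
  have hJ0 : z.imJ = 0 := pow_eq_zero_iff two_ne_zero |>.1 (by linarith only [hJ, hIK])
  have hK0 : z.imK = 0 := pow_eq_zero_iff two_ne_zero |>.1 (by linarith only [hK, hIJ])
  refine ⟨pow_eq_zero_iff two_ne_zero |>.1 ?_, hJ0, hK0⟩
  linarith only [hI, mul_eq_zero_of_left hJ0 z.imK]

theorem coe_inv_binaryTetrahedralGroup (u : binaryTetrahedralGroup) :
    ((u⁻¹ : binaryTetrahedralGroup) : ℍ[ℚ]ˣ).val = star (u : ℍ[ℚ]ˣ).val := by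
  rw [Subgroup.coe_inv]
  apply Units.inv_eq_of_mul_eq_one_right
  rw [Quaternion.self_mul_star, u.2.2, Quaternion.coe_one]

theorem eq_one_or_eq_binaryTetrahedralNegOne_of_mem {A : Subgroup binaryTetrahedralGroup}
    (hA : A.Normal) (hcomm : ∀ x ∈ A, ∀ y ∈ A, x * y = y * x) {a : binaryTetrahedralGroup}
    (ha : a ∈ A) : a = 1 ∨ a = binaryTetrahedralNegOne := by
  have hconj {x : ℍ[ℚ]} (hx : IsHurwitz x) (hnorm : Quaternion.normSq x = 1) :
      Commute (x * (a : ℍ[ℚ]ˣ).val * star x) (a : ℍ[ℚ]ˣ).val := by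
    obtain ⟨g, rfl⟩ := exists_mem_binaryTetrahedralGroup hx hnorm
    rw [← coe_inv_binaryTetrahedralGroup]
    exact congrArg (fun u : binaryTetrahedralGroup ↦ ((u : ℍ[ℚ]ˣ) : ℍ[ℚ]))
      (hcomm _ (hA.conj_mem a ha g) a ha)
  obtain ⟨himI, himJ, himK⟩ := im_eq_zero_of_commute_conj rfl rfl
    (hconj ⟨0, 1, 0, 0, by norm_num⟩ ((Quaternion.normSq_def' _).trans (by norm_num)))
    (hconj ⟨0, 0, 0, 1, by norm_num⟩ ((Quaternion.normSq_def' _).trans (by norm_num)))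
  have hnorm : (a : ℍ[ℚ]ˣ).val.re ^ 2 = 1 := by
    simpa [Quaternion.normSq_def', himI, himJ, himK] using a.2.2
  refine (sq_eq_one_iff.1 hnorm).imp (fun hre ↦ binaryTetrahedralGroup_ext ?_)
    fun hre ↦ binaryTetrahedralGroup_ext ?_
  · ext <;> simp [hre, himI, himJ, himK]
  · rw [coe_binaryTetrahedralNegOne]
    ext <;> simp [hre, himI, himJ, himK]

theorem HasAbelianNormalOfIndexLE.twelve_le
    (h : HasAbelianNormalOfIndexLE binaryTetrahedralGroup d) : 12 ≤ d := by
  obtain ⟨A, hA, hcomm, hidx⟩ := h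
  have hle : A ≤ Subgroup.zpowers binaryTetrahedralNegOne := fun a ha ↦ by
    rcases eq_one_or_eq_binaryTetrahedralNegOne_of_mem hA hcomm ha with rfl | rfl
    · exact one_mem _
    · exact Subgroup.mem_zpowers _
  have hcard : Nat.card A ≤ 2 := by
    rw [← orderOf_binaryTetrahedralNegOne, ← Nat.card_zpowers]
    exact Subgroup.card_le_of_le hle
  have hmul := A.card_mul_index
  rw [card_binaryTetrahedralGroup] at hmul
  nlinarith

theorem IsJordanBound.hasAbelianNormalOfIndexLE (h : IsJordanBound H d) [Finite K] {f : K →* H}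
    (hf : Function.Injective f) : HasAbelianNormalOfIndexLE K d :=
  have : Finite f.range := Finite.of_equiv _ (MonoidHom.ofInjective hf).toEquiv
  HasAbelianNormalOfIndexLE.of_equiv (h f.range this) (MonoidHom.ofInjective hf)

theorem jordanConstant_eq (hd : 0 < d) (h : IsJordanBound H d)
    (hmin : ∀ e, 0 < e → IsJordanBound H e → d ≤ e) : jordanConstant H = d :=
  IsLeast.csInf_eq ⟨⟨hd, h⟩, fun e he ↦ hmin e he.1 he.2⟩

end Jordan

section Main

variable {D : Type*} [Ring D] [IsDomain D] [Algebra ℚ D] [Algebra.IsCentral ℚ D]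

theorem finite_subgroup_classification (hD : Module.finrank ℚ D = 4) (G : Subgroup Dˣ)
    [Finite G] :
    (HasQuaternionBasis D (-1 : ℚ) (-1) ∧
      (Nonempty (G ≃* binaryTetrahedralGroup) ∨ Nonempty (G ≃* QuaternionGroup 2))) ∨
    (HasQuaternionBasis D (-1 : ℚ) (-3) ∧ Nonempty (G ≃* QuaternionGroup 3)) ∨ IsCyclic G :=
  finite_group_classification hD (ρ := (Units.coeHom D).comp G.subtype)
    fun _ _ h ↦ Subtype.ext (Units.ext h)

theorem isJordanBound_twelve (hD : Module.finrank ℚ D = 4) : IsJordanBound Dˣ 12 := by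
  intro G hG
  rcases finite_subgroup_classification hD G with ⟨-, ⟨⟨e⟩⟩ | ⟨⟨e⟩⟩⟩ | ⟨-, ⟨e⟩⟩ | hG
  · exact hasAbelianNormalOfIndexLE_binaryTetrahedralGroup.of_equiv e
  · exact ((hasAbelianNormalOfIndexLE_quaternionGroup 2).of_equiv e).mono (by norm_num)
  · exact ((hasAbelianNormalOfIndexLE_quaternionGroup 3).of_equiv e).mono (by norm_num)
  · exact hasAbelianNormalOfIndexLE_of_isCyclic.mono (by norm_num)

theorem jordanConstant_eq_twelve (hD : Module.finrank ℚ D = 4)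
    (h : HasQuaternionBasis D (-1 : ℚ) (-1)) : jordanConstant Dˣ = 12 := by
  refine jordanConstant_eq (by norm_num) (isJordanBound_twelve hD) fun d _ hd ↦ ?_
  obtain ⟨i, j, hi, hj, hij⟩ := h.exists_anticommute
  rw [map_neg, map_one] at hi hj
  obtain ⟨e, -⟩ := exists_algEquiv_quaternion hD hi hj hij
  exact (hd.hasAbelianNormalOfIndexLE
    (f := (Units.map (e : ℍ[ℚ] →* D)).comp binaryTetrahedralGroup.subtype)
    ((Units.map_injective e.injective).comp Subtype.val_injective)).twelve_le

theorem jordanConstant_eq_two (hD : Module.finrank ℚ D = 4)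
    (h : ¬HasQuaternionBasis D (-1 : ℚ) (-1)) (h' : HasQuaternionBasis D (-1 : ℚ) (-3)) :
    jordanConstant Dˣ = 2 := by
  refine jordanConstant_eq (by norm_num) (fun G hG ↦ ?_) fun d hpos hd ↦ ?_
  · rcases finite_subgroup_classification hD G with ⟨hquat, -⟩ | ⟨-, ⟨e⟩⟩ | hcyc
    · exact absurd hquat h
    · exact (hasAbelianNormalOfIndexLE_quaternionGroup 3).of_equiv e
    · exact hasAbelianNormalOfIndexLE_of_isCyclic.mono (by norm_num)
  · by_contra! hlt
    obtain rfl : d = 1 := by omega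
    obtain ⟨f, hf⟩ := exists_noncommutative_quaternionGroup_three_hom h'
    have : Finite f.range := Finite.of_surjective _ f.rangeRestrict_surjective
    exact hf (congrArg Subtype.val (HasAbelianNormalOfIndexLE.mul_comm (hd f.range this)
      (f.rangeRestrict (.a 1)) (f.rangeRestrict (.xa 0))))

theorem jordanConstant_eq_one (hD : Module.finrank ℚ D = 4)
    (h : ¬HasQuaternionBasis D (-1 : ℚ) (-1)) (h' : ¬HasQuaternionBasis D (-1 : ℚ) (-3)) :
    jordanConstant Dˣ = 1 := by
  refine jordanConstant_eq one_pos (fun G hG ↦ ?_) fun _ hpos _ ↦ hpos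
  rcases finite_subgroup_classification hD G with ⟨hquat, -⟩ | ⟨hquat, -⟩ | hcyc
  · exact absurd hquat h
  · exact absurd hquat h'
  · exact hasAbelianNormalOfIndexLE_of_isCyclic

end Main

theorem mainTheorem2 {D : Type*} [DivisionRing D] [Algebra ℚ D] [Algebra.IsCentral ℚ D]
    (hD : Module.finrank ℚ D = 4) :
    IsJordanGroup Dˣ ∧
    (jordanConstant Dˣ = 12 ↔ ramificationSet D = {placeTwo, .infinite}) ∧
    (jordanConstant Dˣ = 2 ↔ ramificationSet D = {placeThree, .infinite}) ∧
    (jordanConstant Dˣ = 1 ↔ ramificationSet D ≠ {placeTwo, .infinite} ∧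
      ramificationSet D ≠ {placeThree, .infinite}) ∧
    ∀ G : Subgroup Dˣ, Finite G →
      Nonempty (G ≃* binaryTetrahedralGroup) ∨ Nonempty (G ≃* QuaternionGroup 3) ∨
        Nonempty (G ≃* QuaternionGroup 2) ∨ IsCyclic G := by
  have hexcl : ¬(ramificationSet D = {placeTwo, .infinite} ∧
      ramificationSet D = {placeThree, .infinite}) := fun h ↦
    pair_placeTwo_infinite_ne_pair_placeThree_infinite (h.1.symm.trans h.2)
  rw [ne_eq, ne_eq]
  rw [ramificationSet_eq_two_iff hD, ramificationSet_eq_three_iff hD] at hexcl ⊢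
  refine ⟨⟨12, by norm_num, isJordanBound_twelve hD⟩, ?_⟩
  rw [← and_assoc, ← and_assoc]
  refine ⟨?_, fun G hG ↦ ?_⟩
  · by_cases h : HasQuaternionBasis D (-1 : ℚ) (-1)
    · have h' : ¬HasQuaternionBasis D (-1 : ℚ) (-3) := fun h' ↦ hexcl ⟨h, h'⟩
      simp [jordanConstant_eq_twelve hD h, h, h']
    · by_cases h' : HasQuaternionBasis D (-1 : ℚ) (-3)
      · simp [jordanConstant_eq_two hD h h', h, h']
      · simp [jordanConstant_eq_one hD h h', h, h']
  · rcases finite_subgroup_classification hD G with ⟨-, h | h⟩ | ⟨-, h⟩ | h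
    · exact .inl h
    · exact .inr (.inr (.inl h))
    · exact .inr (.inl h)
    · exact .inr (.inr (.inr h))
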